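/- **Setting.** Let $Q$ be a finite acyclic quiver with vertices $0,1,\dots,\rho$ ($\rho\ge 1$), unique source $0$, and $n_{ij}$ arrows from $i$ to $j$, where $n_{ij}=0$ for $i\ge j$. Let $r=(r_0,\dots,r_\rho)$ be a dimension vector with $r_0=1$ and $0<r_i<s_i$ for $i\ge1$, where $s_i=\sum_j n_{ji}r_j$. Assume that $Q$ is $Y$-shaped: vertex $1$ has at most two outgoing arrows, every other vertex $\neq 0$ has at most one, every vertex has at most one incoming arrow whose source is not $0$, and there is a path from $1$ to every $j>1$. Let $\tilde s_i$ be the number of directed paths from $0$ to $i$ and $k_i=\tilde s_i-r_i$. Name the arrows out of $1$ as $a_1,a_2$ (one or both may be missing), let $S_j'$ be the set of vertices reached from $1$ by a path through $a_j$, put $S_j=S_j'\cup\{1\}$, and let $\rho_j=\max S_j$. **Matrices.** Take variables $x^{(i)}_{t,c}$ for $1\le i\le \rho$, $1\le t\le s_i-r_i$, $1\le c\le\tilde s_i$. For $i\ge 1$ let $i^-\neq 0$ be the vertex other than the source with an arrow to $i$ if there is one, and put $k_{i^-}=0$ otherwise. The matrix $M_1$ has rows $1,\dots,k_{\rho_1}$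 and columns $1,\dots,\tilde s_{\rho_1}$; for $i\in S_1$ the entry $x^{(i)}_{t,c}$ is in row $k_{\rho_1}-k_i+t$ and column $\tilde s_{\rho_1}-\tilde s_i+c$, and all other entries are $0$. The matrix $M_2$ has rows $1,\dots,k_{\rho_2}$ and columns $e+1,\dots,e+\tilde s_{\rho_2}$, where $e=\tilde s_{\rho_1}-\tilde s_1$; for $i\in S_2$ the entry $x^{(i)}_{t,c}$ is in row $k_{i^-}+t$ and column $e+c$, and all other entries are $0$. **Plücker algebra.** Let $P_Q$ be the polynomial ring over $\mathbb C$ in variables $p^1_\sigma$, where $\sigma\subseteq\{1,\dots,\tilde s_{\rho_1}\}$, $|\sigma|\in\{k_i: i\in S_1'\}$ and the minor of $M_1$ with columns $\sigma$ and the last $|\sigma|$ rows is not identically zero, and $p^2_\sigma$, where $\sigma\subseteq\{e+1,\dots,e+\tilde s_{\rho_2}\}$, $|\sigma|\in\{k_i: i\in S_2\}$ and the minor of $M_2$ with columns $\sigma$ and the first $|\sigma|$ rows is not identically zero. Let $\varphi:P_Q\to\mathbb C[x^{(i)}_{t,c}]$ be the $\mathbb C$-algebra map sending each variable to its minor. The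 Plücker algebra of $Q$ is $\operatorname{im}(\varphi)$. **Orders.** Write $\sigma=\{\sigma_1<\dots<\sigma_k\}$, $\tau=\{\tau_1<\dots<\tau_l\}$. The partial order $\le$ on the variables is given by: $p^2_\sigma\le p^2_\tau$ iff $k\ge l$ and $\sigma_s\le\tau_s$ for $1\le s\le l$; $p^1_\sigma\le p^1_\tau$ iff $k\le l$ and $\sigma_s\le\tau_{l-k+s}$ for $1\le s\le k$; $p^2_\sigma\le p^1_\tau$ iff $\sigma_s\le\tau_{l-k_1+s}$ for $1\le s\le k_1$; never $p^1_\sigma\le p^2_\tau$. A monomial of $P_Q$ is *semi-standard* if the variables occurring in it form a chain for $\le$. The strict total order $\prec$ on the variables is given by: $p^2_\sigma\prec p^1_\tau$ always; $p^2_\sigma\prec p^2_\tau$ iff $k>l$, or $k=l$ and $\sigma$ is lexicographically smaller than $\tau$; $p^1_\sigma\prec p^1_\tau$ iff $k<l$, or $k=l$ and $\sigma$ is lexicographically smaller than $\tau$. Order the monomials of $P_Q$ by the induced (graded) reverse lexicographic order: $m<m'$ iff $\deg m<\deg m'$, or the degrees are equal and the $\prec$-smallest variable in which the exponents differ has the larger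 exponent in $m$. **Proposition.** The images under $\varphi$ of the distinct semi-standard monomials of $P_Q$ are linearly independent over $\mathbb C$ and span $\operatorname{im}(\varphi)$; that is, they form a $\mathbb C$-basis of the Plücker algebra. Moreover, a monomial of $P_Q$ lies outside the initial ideal of $\ker\varphi$ (the ideal generated by the initial monomials of the nonzero elements of $\ker\varphi$) if and only if it is semi-standard. -/

import Mathlib

/-- A finite quiver with vertex set `{0, …, ρ}`, recorded by the number `n i j` of arrows
from `i` to `j`, together with a dimension vector `r`. -/
structure DimQuiver (ρ : ℕ) where
  n : Fin (ρ + 1) → Fin (ρ + 1) → ℕ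
  r : Fin (ρ + 1) → ℕ

namespace DimQuiver

variable {ρ : ℕ} (Q : DimQuiver ρ)

/-- There is a (possibly trivial) directed path from `i` to `j`. -/
def Reaches (i j : Fin (ρ + 1)) : Prop :=
  Relation.ReflTransGen (fun a b => Q.n a b ≠ 0) i j

/-- `s_i = ∑_{a : t(a) = i} r_{s(a)}`. -/
def s (i : Fin (ρ + 1)) : ℕ := ∑ j, Q.n j i * Q.r j

/-- `s̃_i`, the number of directed paths from the source `0` to `i`: it is `1` for `i = 0`, and
otherwise the sum of `s̃_{s(a)}` over the arrows `a` with target `i` (arrows only go from smaller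
to larger labels). -/
def sTilde (i : Fin (ρ + 1)) : ℕ :=
  if i = 0 then 1
  else ∑ j : Fin i.val, Q.n ⟨j.val, j.isLt.trans i.isLt⟩ i * sTilde ⟨j.val, j.isLt.trans i.isLt⟩
termination_by i.val
decreasing_by exact j.isLt

/-- `k_i = s̃_i - r_i`, the number of rows of the matrix `A_i`. -/
def k (i : Fin (ρ + 1)) : ℕ := Q.sTilde i - Q.r i

/-- The number of rows of `A_i` which come from the matrices `A_{s(a)}`, where `a` runs over the
arrows with target `i` and source different from `0`. -/
def kPrev (i : Fin (ρ + 1)) : ℕ := ∑ j ∈ Finset.univ.erase 0, Q.n j i * Q.k j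

/-- The conditions on the quiver and on the dimension vector of a quiver flag variety:
the quiver is acyclic (and the labelling is compatible with the arrows), `0` is the unique source,
`r_0 = 1`, and `0 < r_i < s_i` for `i ≠ 0`. -/
structure IsQuiverFlag : Prop where
  acyclic : ∀ i j, j ≤ i → Q.n i j = 0
  unique_source : ∀ j, j ≠ 0 → ∃ i, Q.n i j ≠ 0
  r_zero : Q.r 0 = 1
  r_pos : ∀ i, i ≠ 0 → 0 < Q.r i
  r_lt_s : ∀ i, i ≠ 0 → Q.r i < Q.s i

/-- The `Y`-shaped quivers: vertex `1` has at most two outgoing arrows, every other vertex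
different from the source has at most one, every vertex has at most one incoming arrow whose source
is not `0`, and there is a path from `1` to every `j > 1`. -/
structure IsYShaped : Prop where
  one_le : 1 ≤ ρ
  out_one : ∑ j, Q.n 1 j ≤ 2
  out_le : ∀ i, i ≠ 0 → i ≠ 1 → ∑ j, Q.n i j ≤ 1
  in_le : ∀ j, ∑ i ∈ Finset.univ.erase 0, Q.n i j ≤ 1
  path : ∀ j, j ≠ 0 → j ≠ 1 → Q.Reaches 1 j

/-- A naming `a₁`, `a₂` of the (at most two) arrows out of vertex `1`, recorded by their targets;
a missing arrow is `none`. -/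
structure Branching where
  head₁ : Option (Fin (ρ + 1))
  head₂ : Option (Fin (ρ + 1))
  isHead : ∀ v, Q.n 1 v ≠ 0 ↔ head₁ = some v ∨ head₂ = some v
  distinct : ∀ v, ¬ (head₁ = some v ∧ head₂ = some v)

/-- The coordinates `x^{(i)}_{t,c}`, `1 ≤ t ≤ s_i - r_i`, `1 ≤ c ≤ s̃_i` (here `t` and `c` are
counted from `0`). There is none for `i = 0`, as `s_0 = 0`. -/
abbrev Coord : Type := Σ i : Fin (ρ + 1), Fin (Q.s i - Q.r i) × Fin (Q.sTilde i)

/-- The coordinate ring `ℂ[x^{(i)}_{t,c}]`. -/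
abbrev CoordRing : Type := MvPolynomial Q.Coord ℂ

end DimQuiver

/-- The entry of index `s` (counted from `0`) of a strictly increasing sequence of natural numbers;
such a sequence is recorded by the finite set of its entries. -/
def seqEntry (σ : Finset ℕ) (s : ℕ) : ℕ :=
  if h : s < σ.card then σ.orderEmbOfFin rfl ⟨s, h⟩ else 0

/-- `σ` comes strictly before `τ` in the lexicographic order (for sequences of equal length). -/
def seqLexLT (σ τ : Finset ℕ) : Prop :=
  ∃ s < σ.card, (∀ t < s, seqEntry σ t = seqEntry τ t) ∧ seqEntry σ s < seqEntry τ s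

namespace DimQuiver.Branching

variable {ρ : ℕ} {Q : DimQuiver ρ} (B : Q.Branching)

open Classical in
/-- `S₁'`: the vertices `i` such that the path from `1` to `i` contains `a₁`. -/
noncomputable def S₁' : Finset (Fin (ρ + 1)) :=
  Finset.univ.filter fun i => ∃ h, B.head₁ = some h ∧ Q.Reaches h i

open Classical in
/-- `S₂'`: the vertices `i` such that the path from `1` to `i` contains `a₂`. -/
noncomputable def S₂' : Finset (Fin (ρ + 1)) :=
  Finset.univ.filter fun i => ∃ h, B.head₂ = some h ∧ Q.Reaches h i

/-- `S₁ = S₁' ∪ {1}`. -/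
noncomputable def S₁ : Finset (Fin (ρ + 1)) := insert 1 B.S₁'

/-- `S₂ = S₂' ∪ {1}`. -/
noncomputable def S₂ : Finset (Fin (ρ + 1)) := insert 1 B.S₂'

/-- The last vertex `ρ₁` of the first branch. -/
noncomputable def last₁ : Fin (ρ + 1) := B.S₁.max' (Finset.insert_nonempty _ _)

/-- The last vertex `ρ₂` of the second branch. -/
noncomputable def last₂ : Fin (ρ + 1) := B.S₂.max' (Finset.insert_nonempty _ _)

/-- The columns of `M₂` are `shift + 1, …, shift + s̃_{ρ₂}`, where `shift = s̃_{ρ₁} - s̃_1`. -/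
noncomputable def shift : ℕ := Q.sTilde B.last₁ - Q.sTilde 1

/-- Row (counted from `1`) of the coordinate `y = x^{(i)}_{t,c}`, `i ∈ S₁`, in the matrix `M₁` with
`k_{ρ₁}` rows. The matrix `A_i` occupies the bottom `k_i` rows, and the `s_i - r_i` rows
introduced at the vertex `i` are the first of these. -/
noncomputable def row₁ (y : Q.Coord) : ℕ := Q.k B.last₁ - Q.k y.1 + y.2.1.val + 1

/-- Column (counted from `1`) of the coordinate `y = x^{(i)}_{t,c}`, `i ∈ S₁`, in the matrix `M₁`
with `s̃_{ρ₁}` columns: the matrix `A_i` occupies the last `s̃_i` columns. -/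
noncomputable def col₁ (y : Q.Coord) : ℕ := Q.sTilde B.last₁ - Q.sTilde y.1 + y.2.2.val + 1

/-- Row (counted from `1`) of the coordinate `y = x^{(i)}_{t,c}`, `i ∈ S₂`, in the matrix `M₂`.
The matrix `A_i` occupies the top `k_i` rows, and the `s_i - r_i` rows introduced at the
vertex `i` are the last of these. -/
def row₂ (_B : Q.Branching) (y : Q.Coord) : ℕ := Q.kPrev y.1 + y.2.1.val + 1

/-- Column (with the shifted numbering) of the coordinate `y = x^{(i)}_{t,c}`, `i ∈ S₂`, in the
matrix `M₂`: the matrix `A_i` occupies the first `s̃_i` columns. -/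
noncomputable def col₂ (y : Q.Coord) : ℕ := B.shift + y.2.2.val + 1

open Classical in
/-- The matrix `M₁`: each coordinate `y` introduced at a vertex of `S₁` stands at the place
`(row₁ y, col₁ y)`; distinct coordinates have distinct places, and all the other entries are `0`. -/
noncomputable def M₁ (p c : ℕ) : Q.CoordRing :=
  ∑ y : Q.Coord, if y.1 ∈ B.S₁ ∧ B.row₁ y = p ∧ B.col₁ y = c then MvPolynomial.X y else 0

open Classical in
/-- The matrix `M₂`: each coordinate `y` introduced at a vertex of `S₂` stands at the place
`(row₂ y, col₂ y)`; distinct coordinates have distinct places, and all the other entries are `0`. -/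
noncomputable def M₂ (p c : ℕ) : Q.CoordRing :=
  ∑ y : Q.Coord, if y.1 ∈ B.S₂ ∧ B.row₂ y = p ∧ B.col₂ y = c then MvPolynomial.X y else 0

/-- The minor of `M₁` with columns `σ` and the bottom `|σ|` rows
`k_{ρ₁} - |σ| + 1, …, k_{ρ₁}`. -/
noncomputable def minor₁ (σ : Finset ℕ) : Q.CoordRing :=
  (Matrix.of fun i j : Fin σ.card =>
    B.M₁ (Q.k B.last₁ - σ.card + i.val + 1) (σ.orderEmbOfFin rfl j)).det

/-- The minor of `M₂` with columns `σ` and the top `|σ|` rows `1, …, |σ|`. -/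
noncomputable def minor₂ (σ : Finset ℕ) : Q.CoordRing :=
  (Matrix.of fun i j : Fin σ.card => B.M₂ (i.val + 1) (σ.orderEmbOfFin rfl j)).det

/-- The index sets `σ` of the variables `p¹_σ`. -/
abbrev Var₁ : Type :=
  {σ : Finset ℕ // σ ⊆ Finset.Icc 1 (Q.sTilde B.last₁) ∧
    (∃ i ∈ B.S₁', σ.card = Q.k i) ∧ B.minor₁ σ ≠ 0}

/-- The index sets `σ` of the variables `p²_σ`. -/
abbrev Var₂ : Type :=
  {σ : Finset ℕ // σ ⊆ Finset.Icc (B.shift + 1) (B.shift + Q.sTilde B.last₂) ∧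
    (∃ i ∈ B.S₂, σ.card = Q.k i) ∧ B.minor₂ σ ≠ 0}

/-- The variables of `P_Q`: `Sum.inl σ` is `p¹_σ` and `Sum.inr σ` is `p²_σ`. -/
abbrev Var : Type := B.Var₁ ⊕ B.Var₂

/-- The polynomial ring `P_Q = ℂ[p¹_σ, p²_σ]`. -/
abbrev PRing : Type := MvPolynomial B.Var ℂ

/-- The map `φ : P_Q → ℂ[x^{(i)}_{t,c}]` that sends each variable to its minor. -/
noncomputable def phi : B.PRing →ₐ[ℂ] Q.CoordRing :=
  MvPolynomial.aeval (Sum.elim (fun σ => B.minor₁ σ.1) (fun σ => B.minor₂ σ.1))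

/-- The Plücker algebra of the `Y`-shaped quiver. -/
noncomputable def pluckerAlgebra : Subalgebra ℂ Q.CoordRing := B.phi.range

/-- The partial order `≤` on the variables of `P_Q`. The index sets of two variables `p²` are
aligned at their first entries (top-aligned minors), those of two variables `p¹` at their last
entries (bottom-aligned minors), and the first `k_1` entries of the index set of a `p²`
are compared with the last `k_1` entries of the index set of a `p¹`. -/
def varLE : B.Var → B.Var → Prop
  | .inr σ, .inr τ => τ.1.card ≤ σ.1.card ∧
      ∀ s < τ.1.card, seqEntry σ.1 s ≤ seqEntry τ.1 s
  | .inl σ, .inl τ => σ.1.card ≤ τ.1.card ∧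
      ∀ s < σ.1.card, seqEntry σ.1 s ≤ seqEntry τ.1 (τ.1.card - σ.1.card + s)
  | .inr σ, .inl τ => ∀ s < Q.k 1, seqEntry σ.1 s ≤ seqEntry τ.1 (τ.1.card - Q.k 1 + s)
  | .inl _, .inr _ => False

/-- The strict total order `≺` on the variables of `P_Q`. -/
def varLT : B.Var → B.Var → Prop
  | .inr σ, .inr τ => τ.1.card < σ.1.card ∨ (σ.1.card = τ.1.card ∧ seqLexLT σ.1 τ.1)
  | .inl σ, .inl τ => σ.1.card < τ.1.card ∨ (σ.1.card = τ.1.card ∧ seqLexLT σ.1 τ.1)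
  | .inr _, .inl _ => True
  | .inl _, .inr _ => False

/-- The reverse lexicographic term order induced by `≺`: `m` is smaller than `m'` if it has smaller
degree, or the same degree and the `≺`-smallest variable at which the exponents differ
has the larger exponent in `m`. -/
def monomialLT (m m' : B.Var →₀ ℕ) : Prop :=
  m.degree < m'.degree ∨
    (m.degree = m'.degree ∧ ∃ p, (∀ q, B.varLT q p → m q = m' q) ∧ m' p < m p)

/-- `m` is the exponent of the initial monomial of `f`. -/
def IsInitialMonomial (f : B.PRing) (m : B.Var →₀ ℕ) : Prop :=
  m ∈ f.support ∧ ∀ m' ∈ f.support, m' ≠ m → B.monomialLT m' m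

/-- The initial ideal of an ideal of `P_Q`, generated by the initial monomials of its elements. -/
noncomputable def initialIdeal (I : Ideal B.PRing) : Ideal B.PRing :=
  Ideal.span {g | ∃ f ∈ I, ∃ m, B.IsInitialMonomial f m ∧ g = MvPolynomial.monomial m 1}

/-- A monomial is semi-standard if it is supported on a chain of the partial order `≤`. -/
def IsSemistandard (m : B.Var →₀ ℕ) : Prop :=
  IsChain B.varLE (m.support : Set B.Var)

end DimQuiver.Branching

/-! The rows of vertex 1 are the last `k 1` rows of `M₁` and the first `k 1` rows of `M₂`. Gluing
the two matrices along these rows gives a single matrix whose entries are distinct variables on a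
staircase and zeros elsewhere: the support of each row that is not zero is an interval of columns,
and both ends of the interval move weakly to the right as one goes down. Every minor in question
then uses consecutive rows of the glued matrix. A minor of type p¹ ends with the last shared row and
a minor of type p² begins with the first shared row, so all the row intervals contain the first
shared row, and any two of them are ordered by both ends at once. In these terms `p ≤ q` means that
the rows of `q` begin and end no later than those of `p` and that the column indices of `p` do not
exceed those of `q` on the common rows. This common language is `MinorSystem`.

Independence. Give the variable at the place `(r, c)` the weight `r * c`. By the rearrangement
inequality the diagonal term of an interval minor is strictly heavier than all the others, and the
staircase shape ensures that it is present whenever the minor is nonzero. Leading exponents add up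
in products, so it suffices that a chain with multiplicities can be recovered from the sum of its
diagonals (`eq_of_leadExp_eq`). The sum determines the least element of the chain (`least_eq`);
remove it and repeat.

Spanning. If `p` precedes `q` and some common row `r₀` has a larger column in `p` than in `q`, then
the columns of `p` from `r₀` on and those of `q` up to `r₀` together exceed by one the number of
rows that the two minors occupy. Alternating over all the permutations of these columns gives zero,
which expresses the product through products whose first factor has the rows of `p` and a
lexicographically smaller column set (`minor_mul_mem_span`). Such products are smaller in the
reverse lexicographic order, and there are finitely many monomials of a given degree, so the
rewriting terminates (`phi_monomial_mem_span`).

Initial ideal. The straightening relations have the incomparable products as initial monomials, so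
every monomial that is not semi-standard lies in the initial ideal. A semi-standard monomial in the
initial ideal would have an image spanned by the images of smaller semi-standard monomials, against
independence. -/

namespace StaircaseMinor

open MvPolynomial

/-! ### Leading monomials with respect to a weight -/

/-- The weight of a monomial in the variables `X (r, c)`, where `X (r, c)` has weight `r * c`. -/
noncomputable def posWeight : (ℕ × ℕ →₀ ℕ) →+ ℕ :=
  Finsupp.weight (fun x : ℕ × ℕ => x.1 * x.2)

/-- `f` is the sum of the monomial with exponent `d` and of terms of smaller weight. -/
def HasLead (f : MvPolynomial (ℕ × ℕ) ℂ) (d : ℕ × ℕ →₀ ℕ) : Prop :=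
  coeff d f = 1 ∧ ∀ d' ∈ f.support, d' ≠ d → posWeight d' < posWeight d

theorem HasLead.le {f : MvPolynomial (ℕ × ℕ) ℂ} {d d' : ℕ × ℕ →₀ ℕ} (h : HasLead f d)
    (hd' : d' ∈ f.support) : posWeight d' ≤ posWeight d := by
  by_cases hne : d' = d
  · rw [hne]
  · exact (h.2 d' hd' hne).le

theorem hasLead_one : HasLead 1 0 := by
  refine ⟨by simp, fun d' hd' hne => absurd (by simpa using hd') hne⟩

/-- Weights add, so a product of two terms reaches the maximal weight only if both factors do; hence
no cancellation can affect the leading term. -/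
theorem HasLead.mul {f g : MvPolynomial (ℕ × ℕ) ℂ} {d e : ℕ × ℕ →₀ ℕ} (hf : HasLead f d)
    (hg : HasLead g e) : HasLead (f * g) (d + e) := by
  classical
  refine ⟨?_, fun x hx hne => ?_⟩
  · rw [coeff_mul, Finset.sum_eq_single (d, e)]
    · simp [hf.1, hg.1]
    · rintro ⟨a, b⟩ hab hne
      rw [Finset.HasAntidiagonal.mem_antidiagonal] at hab
      simp only at hab
      by_contra h0
      have ha : a ∈ f.support := mem_support_iff.2 (left_ne_zero_of_mul h0)
      have hb : b ∈ g.support := mem_support_iff.2 (right_ne_zero_of_mul h0)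
      have hsum : posWeight a + posWeight b = posWeight d + posWeight e := by
        rw [← map_add, ← map_add, hab]
      have h1 := hf.le ha
      have h2 := hg.le hb
      have had : a = d := by
        by_contra hh
        have := hf.2 a ha hh
        omega
      have hbe : b = e := by
        by_contra hh
        have := hg.2 b hb hh
        omega
      exact hne (by rw [had, hbe])
    · intro h
      exact (h (by rw [Finset.HasAntidiagonal.mem_antidiagonal])).elim
  · obtain ⟨a, ha, b, hb, rfl⟩ := Finset.mem_add.1 (support_mul f g hx)
    rw [map_add, map_add]
    have h1 := hf.le ha
    have h2 := hg.le hb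
    by_cases had : a = d
    · have hbe : b ≠ e := fun hh => hne (by rw [had, hh])
      have := hg.2 b hb hbe
      omega
    · have := hf.2 a ha had
      omega

theorem HasLead.pow {f : MvPolynomial (ℕ × ℕ) ℂ} {d : ℕ × ℕ →₀ ℕ} (hf : HasLead f d) (n : ℕ) :
    HasLead (f ^ n) (n • d) := by
  induction n with
  | zero => simpa using hasLead_one
  | succ n ih =>
    rw [pow_succ, succ_nsmul]
    exact ih.mul hf

/-- Polynomials with distinct leading exponents are linearly independent. -/
theorem linearIndependent_of_hasLead {ι : Type*} {f : ι → MvPolynomial (ℕ × ℕ) ℂ}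
    {d : ι → ℕ × ℕ →₀ ℕ} (hd : Function.Injective d) (hf : ∀ i, HasLead (f i) (d i)) :
    LinearIndependent ℂ f := by
  classical
  rw [linearIndependent_iff']
  intro s g hg i hi
  by_contra hgi
  -- Among the indices with a nonzero coefficient, one of maximal leading weight: no other summand
  -- can contain its leading exponent.
  obtain ⟨j, hj, hmax⟩ := Finset.exists_max_image (s.filter fun i => g i ≠ 0)
    (fun i => posWeight (d i)) ⟨i, Finset.mem_filter.2 ⟨hi, hgi⟩⟩
  rw [Finset.mem_filter] at hj
  apply hj.2
  have h0 := congrArg (coeff (d j)) hg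
  rw [coeff_sum, coeff_zero, Finset.sum_eq_single j] at h0
  · simpa [coeff_smul, (hf j).1] using h0
  · intro l hl hlj
    rw [coeff_smul, smul_eq_mul]
    by_contra hne
    have hsup : d j ∈ (f l).support := mem_support_iff.2 (right_ne_zero_of_mul hne)
    have h1 := (hf l).2 _ hsup (fun h => hlj (hd h.symm))
    have h2 := hmax l (Finset.mem_filter.2 ⟨hl, left_ne_zero_of_mul hne⟩)
    omega
  · intro h
    exact absurd hj.1 h

/-! ### Interval minors of a generic staircase matrix -/

/-- A set of positions is a staircase if it contains, together with the ends of a weakly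
antidiagonal pair of positions, the columns in between in both rows. -/
def IsStair (S : ℕ → ℕ → Prop) : Prop :=
  ∀ p p' c c' d, p ≤ p' → S p c' → S p' c → c ≤ d → d ≤ c' → S p d ∧ S p' d

open Classical in
/-- The generic matrix with support `S`. -/
noncomputable def genericMatrix (S : ℕ → ℕ → Prop) (r c : ℕ) : MvPolynomial (ℕ × ℕ) ℂ :=
  if S r c then X (r, c) else 0

/-- The minor of `N` with rows `u, …, w - 1`, whose columns are the values of `c` on these rows. -/
noncomputable def intervalMinor {R : Type*} [CommRing R] (N : ℕ → ℕ → R) (u w : ℕ) (c : ℕ → ℕ) :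
    R :=
  (Matrix.of fun i j : Finset.Ico u w => N i (c j)).det

theorem intervalMinor_congr {R : Type*} [CommRing R] (N : ℕ → ℕ → R) {u w : ℕ} {c c' : ℕ → ℕ}
    (h : ∀ r ∈ Finset.Ico u w, c r = c' r) : intervalMinor N u w c = intervalMinor N u w c' := by
  unfold intervalMinor
  congr 1
  ext i j
  simp [h j.1 j.2]

/-- The exponent of the diagonal monomial of an interval minor. -/
noncomputable def diagExp (u w : ℕ) (c : ℕ → ℕ) : ℕ × ℕ →₀ ℕ :=
  ∑ r ∈ Finset.Ico u w, Finsupp.single (r, c r) 1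

/-- Pigeonhole: otherwise `π` would inject the elements `≥ r` into the elements `> r`. -/
theorem exists_perm_le {ι : Type*} [Fintype ι] [LinearOrder ι] (π : Equiv.Perm ι) (r : ι) :
    ∃ r', r ≤ r' ∧ π r' ≤ r := by
  by_contra! h
  have h1 : (Finset.univ.filter fun x => r ≤ x).card ≤ (Finset.univ.filter fun x => r < x).card :=
    Finset.card_le_card_of_injOn π (fun x hx => by
      simp only [Finset.coe_filter, Finset.mem_univ, true_and, Set.mem_ofPred_eq] at hx ⊢
      exact h x hx) π.injective.injOn
  have h2 : (Finset.univ.filter fun x => r < x).card < (Finset.univ.filter fun x => r ≤ x).card := by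
    refine Finset.card_lt_card ⟨fun x hx => ?_, fun hh => ?_⟩
    · simp only [Finset.mem_filter, Finset.mem_univ, true_and] at hx ⊢
      exact hx.le
    · have := hh (show r ∈ _ by simp)
      simp at this
  omega

theorem exists_perm_ge {ι : Type*} [Fintype ι] [LinearOrder ι] (π : Equiv.Perm ι) (r : ι) :
    ∃ r', r' ≤ r ∧ r ≤ π r' :=
  exists_perm_le (ι := ιᵒᵈ) π r

/-- If an interval minor of a generic staircase matrix does not vanish, then the diagonal positions
belong to the staircase. -/
theorem diag_mem_of_intervalMinor_ne_zero {S : ℕ → ℕ → Prop} (hS : IsStair S) {u w : ℕ}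
    {c : ℕ → ℕ} (hc : StrictMonoOn c (Set.Ico u w))
    (h : intervalMinor (genericMatrix S) u w c ≠ 0) {r : ℕ} (hr : r ∈ Finset.Ico u w) :
    S r (c r) := by
  classical
  unfold intervalMinor at h
  rw [Matrix.det_apply] at h
  obtain ⟨π, -, hπ⟩ := Finset.exists_ne_zero_of_sum_ne_zero h
  have hprod : ∏ i, Matrix.of (fun i j : Finset.Ico u w => genericMatrix S i (c j)) (π i) i ≠ 0 :=
    fun h0 => hπ (by rw [h0, smul_zero])
  have hmem : ∀ i : Finset.Ico u w, S (π i) (c i) := by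
    intro i
    have := Finset.prod_ne_zero_iff.1 hprod i (Finset.mem_univ _)
    by_contra hn
    exact this (by simp [genericMatrix, hn])
  have hmono : ∀ i j : Finset.Ico u w, i ≤ j → c i ≤ c j := fun i j hij =>
    hc.monotoneOn (Finset.mem_Ico.1 i.2) (Finset.mem_Ico.1 j.2) hij
  set R : Finset.Ico u w := ⟨r, hr⟩
  -- The term of `π` has one factor in row `R`, at the column of `π.symm R`. If this column lies to
  -- the right of the diagonal, some factor in row `R` or below lies weakly to the left of the
  -- diagonal column; the two form a weakly antidiagonal pair that encloses the diagonal place. The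
  -- other case is symmetric.
  rcases le_total R (π.symm R) with h1 | h1
  · obtain ⟨i, hi, hi'⟩ := exists_perm_ge π R
    have := hS R (π i) (c i) (c (π.symm R)) (c R) hi'
      (by simpa using hmem (π.symm R)) (hmem i) (hmono _ _ hi) (hmono _ _ h1)
    exact this.1
  · obtain ⟨i, hi, hi'⟩ := exists_perm_le π R
    have := hS (π i) R (c (π.symm R)) (c i) (c R) hi' (hmem i)
      (by simpa using hmem (π.symm R)) (hmono _ _ h1) (hmono _ _ hi)
    exact this.2

theorem perm_eq_one_of_monotone {ι : Type*} [Fintype ι] [LinearOrder ι] {π : Equiv.Perm ι}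
    (h : Monotone π) : π = 1 := by
  ext r
  obtain ⟨i, hi, hi'⟩ := exists_perm_ge π r
  obtain ⟨j, hj, hj'⟩ := exists_perm_le π r
  exact le_antisymm ((h hj).trans hj') (hi'.trans (h hi))

/-- The term of `π` has weight `∑ π(i) c(i)`, which by the rearrangement inequality is strictly
maximal at the identity, since the columns strictly increase. Terms that meet a zero entry of the
matrix simply drop out. -/
theorem hasLead_intervalMinor {S : ℕ → ℕ → Prop} {u w : ℕ}
    {c : ℕ → ℕ} (hc : StrictMonoOn c (Set.Ico u w))
    (h : ∀ r ∈ Finset.Ico u w, S r (c r)) :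
    HasLead (intervalMinor (genericMatrix S) u w c) (diagExp u w c) := by
  classical
  have hcs : StrictMono fun i : Finset.Ico u w => c i := fun i j hij =>
    hc (Finset.mem_Ico.1 i.2) (Finset.mem_Ico.1 j.2) hij
  let D : Equiv.Perm (Finset.Ico u w) → (ℕ × ℕ →₀ ℕ) := fun π =>
    ∑ i, Finsupp.single ((π i : ℕ), c i) 1
  have hD1 : D 1 = diagExp u w c := by
    simp only [D, diagExp, Equiv.Perm.coe_one, id]
    exact Finset.sum_coe_sort (Finset.Ico u w) (fun r => Finsupp.single (r, c r) 1)
  have hW : ∀ π, π ≠ 1 → posWeight (D π) < posWeight (D 1) := by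
    intro π hπ
    have hw : ∀ π, posWeight (D π) = ∑ i, (π i : ℕ) * c i := by
      intro π
      simp only [D, map_sum, posWeight, Finsupp.weight_single, one_smul]
    rw [hw, hw]
    refine (Monovary.sum_comp_perm_mul_lt_sum_mul_iff (f := fun i : Finset.Ico u w => (i : ℕ))
      (g := fun i : Finset.Ico u w => c i) (σ := π) ?_).2 ?_
    · intro i j hij
      exact (hcs.lt_iff_lt.1 hij).le
    · intro hmv
      refine hπ (perm_eq_one_of_monotone fun i j hij => ?_)
      rcases hij.eq_or_lt with rfl | hlt
      · exact le_rfl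
      · exact hmv (hcs hlt)
  have hterm : ∀ π : Equiv.Perm (Finset.Ico u w),
      ∏ i, genericMatrix S (π i) (c i) = 0 ∨
      ∏ i, genericMatrix S (π i) (c i) = monomial (D π) 1 := by
    intro π
    by_cases hall : ∀ i, S (π i) (c i)
    · right
      simp only [D]
      rw [show (monomial (∑ i, Finsupp.single ((π i : ℕ), c i) 1) (1 : ℂ)) =
        ∏ i, monomial (Finsupp.single ((π i : ℕ), c i) 1) 1 by rw [monomial_sum_one]]
      refine Finset.prod_congr rfl fun i _ => ?_
      simp [genericMatrix, hall i, X]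
    · left
      push Not at hall
      obtain ⟨i, hi⟩ := hall
      exact Finset.prod_eq_zero (Finset.mem_univ i) (by simp [genericMatrix, hi])
  have hcoeff : ∀ d, coeff d (intervalMinor (genericMatrix S) u w c) =
      ∑ π : Equiv.Perm (Finset.Ico u w),
        ((Equiv.Perm.sign π : ℤ) : ℂ) * coeff d (∏ i, genericMatrix S (π i) (c i)) := by
    intro d
    simp only [intervalMinor, Matrix.det_apply, coeff_sum, Matrix.of_apply]
    refine Finset.sum_congr rfl fun π _ => ?_
    rw [Units.smul_def, zsmul_eq_mul, ← map_intCast (C (σ := ℕ × ℕ) (R := ℂ)), coeff_C_mul]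
  constructor
  · rw [hcoeff, Finset.sum_eq_single 1]
    · have h1 : ∏ i : Finset.Ico u w, genericMatrix S ((1 : Equiv.Perm (Finset.Ico u w)) i) (c i) =
          monomial (D 1) 1 := by
        refine (hterm 1).resolve_left ?_
        refine Finset.prod_ne_zero_iff.2 ?_
        intro i _
        simp [genericMatrix, h i i.2]
      rw [h1, hD1]
      simp
    · intro π _ hπ
      rcases hterm π with h0 | h0
      · rw [h0, coeff_zero, mul_zero]
      · rw [h0, coeff_monomial, if_neg, mul_zero]
        intro hh
        have := hW π hπ
        rw [hh, hD1] at this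
        exact lt_irrefl _ this
    · simp
  · intro d hd hne
    rw [mem_support_iff, hcoeff] at hd
    obtain ⟨π, -, hπ⟩ := Finset.exists_ne_zero_of_sum_ne_zero hd
    have h1 := right_ne_zero_of_mul hπ
    rcases hterm π with h0 | h0
    · rw [h0, coeff_zero] at h1
      exact absurd rfl h1
    · rw [h0, coeff_monomial] at h1
      have hdπ : D π = d := by
        by_contra hh
        exact h1 (if_neg hh)
      rw [← hdπ, ← hD1]
      refine hW π fun hh => hne ?_
      rw [← hdπ, hh, hD1]

end StaircaseMinor

namespace StaircaseMinor

open MvPolynomial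

/-! ### The exchange relation for a product of two minors -/

section Exchange

variable {R : Type*} [CommRing R]

/-- With more columns than available rows, two factors use the same row; the sum is then a
determinant with a repeated column. -/
theorem sum_perm_prod_eq_zero {X : Type*} [Fintype X] [DecidableEq X] (N : ℕ → ℕ → R)
    (D : Finset ℕ) (hD : D.card < Fintype.card X) (f : X → ℕ) (hf : ∀ x, f x ∈ D) (w : X → ℕ) :
    ∑ π : Equiv.Perm X, Equiv.Perm.sign π • ∏ x, N (f x) (w (π x)) = 0 := by
  obtain ⟨x, -, y, -, hxy, hfxy⟩ := Finset.exists_ne_map_eq_of_card_lt_of_maps_to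
    (s := Finset.univ) (t := D) hD (f := f) (fun x _ => hf x)
  have h := Matrix.det_zero_of_column_eq (M := Matrix.of fun y x => N (f x) (w y)) hxy
    (fun k => by simp [hfxy])
  rwa [Matrix.det_apply] at h

variable {P X₁ X₂ Q : Type*} [Fintype P] [Fintype X₁] [Fintype X₂] [Fintype Q]
  [DecidableEq P] [DecidableEq X₁] [DecidableEq X₂] [DecidableEq Q]

/-- The product of two minors of `N`; the first has columns `cP` and the second part of `w`, the
second has the first part of `w` and the columns `cQ`. -/
def minorProd (N : ℕ → ℕ → R) (rA : P ⊕ X₁ → ℕ) (rB : X₂ ⊕ Q → ℕ) (cP : P → ℕ) (cQ : Q → ℕ)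
    (w : X₂ ⊕ X₁ → ℕ) : R :=
  (Matrix.of fun i j => N (rA i) (Sum.elim cP (fun x => w (Sum.inr x)) j)).det *
    (Matrix.of fun i j => N (rB i) (Sum.elim (fun x => w (Sum.inl x)) cQ j)).det

/-- The alternating sum of a product of two minors over the permutations of more columns than there
are rows vanishes. -/
theorem sum_perm_minorProd_eq_zero (N : ℕ → ℕ → R) (rA : P ⊕ X₁ → ℕ) (rB : X₂ ⊕ Q → ℕ)
    (cP : P → ℕ) (cQ : Q → ℕ) (w : X₂ ⊕ X₁ → ℕ) (D : Finset ℕ)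
    (hD : D.card < Fintype.card (X₂ ⊕ X₁)) (hA : ∀ i, rA i ∈ D) (hB : ∀ i, rB i ∈ D) :
    ∑ π : Equiv.Perm (X₂ ⊕ X₁),
      Equiv.Perm.sign π • minorProd N rA rB cP cQ (fun x => w (π x)) = 0 := by
  have key : ∀ v : X₂ ⊕ X₁ → ℕ, minorProd N rA rB cP cQ v =
      ∑ α : Equiv.Perm (P ⊕ X₁), ∑ β : Equiv.Perm (X₂ ⊕ Q),
        (((Equiv.Perm.sign α : ℤ) : R) * ((Equiv.Perm.sign β : ℤ) : R) *
          (∏ i, N (rA (α (Sum.inl i))) (cP i)) * (∏ i, N (rB (β (Sum.inr i))) (cQ i))) *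
        ∏ x, N (Sum.elim (fun i => rB (β (Sum.inl i))) (fun i => rA (α (Sum.inr i))) x) (v x) := by
    intro v
    rw [minorProd, Matrix.det_apply, Matrix.det_apply, Finset.sum_mul_sum]
    refine Finset.sum_congr rfl fun α _ => Finset.sum_congr rfl fun β _ => ?_
    simp only [Fintype.prod_sum_type, Matrix.of_apply, Sum.elim_inl, Sum.elim_inr, Units.smul_def,
      zsmul_eq_mul]
    ring
  simp only [key, Finset.smul_sum]
  rw [Finset.sum_comm]
  refine Finset.sum_eq_zero fun α _ => ?_
  rw [Finset.sum_comm]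
  refine Finset.sum_eq_zero fun β _ => ?_
  have h0 := sum_perm_prod_eq_zero N D hD
    (Sum.elim (fun i => rB (β (Sum.inl i))) (fun i => rA (α (Sum.inr i))))
    (by rintro (x | x); exacts [hB _, hA _]) w
  simp only [← mul_smul_comm, ← Finset.mul_sum]
  rw [h0, mul_zero]

/-- A permutation that moves no column between the two minors only multiplies each determinant by a
sign, and these signs cancel the sign of the permutation. -/
theorem sign_smul_minorProd_sumCongr (N : ℕ → ℕ → R) (rA : P ⊕ X₁ → ℕ) (rB : X₂ ⊕ Q → ℕ)
    (cP : P → ℕ) (cQ : Q → ℕ) (w : X₂ ⊕ X₁ → ℕ) (π₂ : Equiv.Perm X₂) (π₁ : Equiv.Perm X₁) :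
    Equiv.Perm.sign (Equiv.sumCongr π₂ π₁) •
      minorProd N rA rB cP cQ (fun x => w (Equiv.sumCongr π₂ π₁ x)) =
      minorProd N rA rB cP cQ w := by
  have h1 := Matrix.det_permute' (Equiv.sumCongr (1 : Equiv.Perm P) π₁)
    (Matrix.of fun i j => N (rA i) (Sum.elim cP (fun x => w (Sum.inr x)) j))
  have h2 := Matrix.det_permute' (Equiv.sumCongr π₂ (1 : Equiv.Perm Q))
    (Matrix.of fun i j => N (rB i) (Sum.elim (fun x => w (Sum.inl x)) cQ j))
  rw [Equiv.Perm.sign_sumCongr, Equiv.Perm.sign_one, one_mul] at h1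
  rw [Equiv.Perm.sign_sumCongr, Equiv.Perm.sign_one, mul_one] at h2
  have e1 : (Matrix.of fun i j => N (rA i) (Sum.elim cP
        (fun x => w (Equiv.sumCongr π₂ π₁ (Sum.inr x))) j)) =
      (Matrix.of fun i j => N (rA i) (Sum.elim cP (fun x => w (Sum.inr x)) j)).submatrix id
        (Equiv.sumCongr (1 : Equiv.Perm P) π₁) := by
    ext i j
    rcases j with j | j <;> simp
  have e2 : (Matrix.of fun i j => N (rB i) (Sum.elim
        (fun x => w (Equiv.sumCongr π₂ π₁ (Sum.inl x))) cQ j)) =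
      (Matrix.of fun i j => N (rB i) (Sum.elim (fun x => w (Sum.inl x)) cQ j)).submatrix id
        (Equiv.sumCongr π₂ (1 : Equiv.Perm Q)) := by
    ext i j
    rcases j with j | j <;> simp
  unfold minorProd
  rw [e1, e2, h1, h2, Equiv.Perm.sign_sumCongr, Units.smul_def, zsmul_eq_mul]
  rcases Int.units_eq_one_or (Equiv.Perm.sign π₁) with h | h <;>
  rcases Int.units_eq_one_or (Equiv.Perm.sign π₂) with h' | h' <;> simp [h, h']

/-- A submodule that contains all the nontrivial exchanges of a product of two minors contains
the product. -/
theorem minorProd_mem_of_exchange [Algebra ℂ R] (N : ℕ → ℕ → R) (rA : P ⊕ X₁ → ℕ)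
    (rB : X₂ ⊕ Q → ℕ) (cP : P → ℕ) (cQ : Q → ℕ) (w : X₂ ⊕ X₁ → ℕ) (D : Finset ℕ)
    (hD : D.card < Fintype.card (X₂ ⊕ X₁)) (hA : ∀ i, rA i ∈ D) (hB : ∀ i, rB i ∈ D)
    (W : Submodule ℂ R)
    (hW : ∀ π : Equiv.Perm (X₂ ⊕ X₁), (∃ x y, π (Sum.inr x) = Sum.inl y) →
      minorProd N rA rB cP cQ (fun x => w (π x)) ∈ W) :
    minorProd N rA rB cP cQ w ∈ W := by
  classical
  have h0 := sum_perm_minorProd_eq_zero N rA rB cP cQ w D hD hA hB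
  rw [← Finset.sum_filter_add_sum_filter_not Finset.univ
    (fun π : Equiv.Perm (X₂ ⊕ X₁) => ∃ x y, π (Sum.inr x) = Sum.inl y)] at h0
  have h1 : ∀ π ∈ Finset.univ.filter
      (fun π : Equiv.Perm (X₂ ⊕ X₁) => ¬ ∃ x y, π (Sum.inr x) = Sum.inl y),
      Equiv.Perm.sign π • minorProd N rA rB cP cQ (fun x => w (π x)) =
        minorProd N rA rB cP cQ w := by
    intro π hπ
    have hπ' := (Finset.mem_filter.1 hπ).2
    have hex : ∀ x, ∃ y, π (Sum.inr x) = Sum.inr y := by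
      intro x
      rcases hx : π (Sum.inr x) with y | y
      · exact absurd ⟨x, y, hx⟩ hπ'
      · exact ⟨y, rfl⟩
    choose g hg using hex
    have hginj : Function.Injective g := fun x y hxy =>
      Sum.inr_injective (π.injective (by rw [hg, hg, hxy]))
    have hmaps' : Set.MapsTo π (Set.range Sum.inl) (Set.range Sum.inl) := by
      rintro _ ⟨x, rfl⟩
      rcases hx : π (Sum.inl x) with y | y
      · exact ⟨y, rfl⟩
      · obtain ⟨z, rfl⟩ := Finite.surjective_of_injective hginj y
        have := π.injective ((hg z).trans hx.symm)
        simp at this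
    obtain ⟨⟨π₂, π₁⟩, hπe⟩ := Equiv.Perm.mem_sumCongrHom_range_of_perm_mapsTo_inl hmaps'
    have hπe' : π = Equiv.sumCongr π₂ π₁ := hπe.symm
    rw [hπe']
    exact sign_smul_minorProd_sumCongr N rA rB cP cQ w π₂ π₁
  rw [Finset.sum_congr rfl h1, Finset.sum_const] at h0
  -- The permutations that move nothing across contribute `n` equal copies of the product. The
  -- identity is one of them, so `n` is invertible in `ℂ`.
  set n := (Finset.univ.filter
      (fun π : Equiv.Perm (X₂ ⊕ X₁) => ¬ ∃ x y, π (Sum.inr x) = Sum.inl y)).card with hn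
  have hn0 : (n : ℂ) ≠ 0 := by
    rw [Nat.cast_ne_zero, hn]
    refine Finset.card_ne_zero_of_mem (a := 1) ?_
    simp
  have h2 : n • minorProd N rA rB cP cQ w ∈ W := by
    rw [← neg_eq_of_add_eq_zero_right h0]
    refine W.neg_mem (W.sum_mem fun π hπ => ?_)
    rw [Units.smul_def]
    exact zsmul_mem (hW π (Finset.mem_filter.1 hπ).2) _
  rw [← Nat.cast_smul_eq_nsmul ℂ] at h2
  exact (W.smul_mem_iff hn0).1 h2

end Exchange

/-! ### Sorting the columns of a minor -/

section Sorting

variable {R : Type*} [CommRing R]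

theorem intervalMinor_eq_zero_of_not_injOn (N : ℕ → ℕ → R) {u w : ℕ} {c : ℕ → ℕ}
    (h : ¬ Set.InjOn c (Set.Ico u w)) : intervalMinor N u w c = 0 := by
  unfold Set.InjOn at h
  push Not at h
  obtain ⟨i, hi, j, hj, hij, hne⟩ := h
  refine Matrix.det_zero_of_column_eq (i := ⟨i, Finset.mem_Ico.2 hi⟩)
    (j := ⟨j, Finset.mem_Ico.2 hj⟩) (by simpa using hne) fun k => by simp [hij]

theorem seqEntry_of_lt {σ : Finset ℕ} {s : ℕ} (h : s < σ.card) :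
    seqEntry σ s = σ.orderEmbOfFin rfl ⟨s, h⟩ := dif_pos h

theorem seqEntry_strictMonoOn (σ : Finset ℕ) (u : ℕ) :
    StrictMonoOn (fun r => seqEntry σ (r - u)) (Set.Ico u (u + σ.card)) := by
  intro i hi j hj hij
  obtain ⟨hi1, hi2⟩ := hi
  obtain ⟨hj1, hj2⟩ := hj
  simp only
  rw [seqEntry_of_lt (show i - u < σ.card by omega), seqEntry_of_lt (show j - u < σ.card by omega)]
  refine (σ.orderEmbOfFin rfl).strictMono ?_
  rw [Fin.mk_lt_mk]
  omega

theorem seqEntry_image (σ : Finset ℕ) (u : ℕ) :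
    (fun r => seqEntry σ (r - u)) '' Set.Ico u (u + σ.card) = σ := by
  ext x
  rw [← Finset.range_orderEmbOfFin σ rfl]
  constructor
  · rintro ⟨r, ⟨h1, h2⟩, rfl⟩
    exact ⟨⟨r - u, by omega⟩, (seqEntry_of_lt _).symm⟩
  · rintro ⟨s, rfl⟩
    refine ⟨u + s, ⟨by omega, by omega⟩, ?_⟩
    simp only [Nat.add_sub_cancel_left]
    exact seqEntry_of_lt s.2

/-- Up to the sign, a minor with distinct columns is a minor with increasing columns. -/
theorem exists_sorted_intervalMinor (N : ℕ → ℕ → R) {u w : ℕ} {c : ℕ → ℕ}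
    (hc : Set.InjOn c (Set.Ico u w)) :
    ∃ c', StrictMonoOn c' (Set.Ico u w) ∧ c' '' Set.Ico u w = c '' Set.Ico u w ∧
      ∃ ε : ℤˣ, intervalMinor N u w c = ε • intervalMinor N u w c' := by
  classical
  rcases le_or_gt w u with hwu | huw
  · refine ⟨c, ?_, rfl, 1, by simp⟩
    simp [Set.Ico_eq_empty_of_le hwu, StrictMonoOn]
  set s : Finset ℕ := (Finset.Ico u w).image c with hs
  have hcard : s.card = w - u := by
    rw [hs, Finset.card_image_of_injOn (by simpa using hc), Nat.card_Ico]
  have hw : u + s.card = w := by omega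
  have hmono := seqEntry_strictMonoOn s u
  have himg := seqEntry_image s u
  rw [hw] at hmono himg
  have himg' : (fun r => seqEntry s (r - u)) '' Set.Ico u w = c '' Set.Ico u w := by
    rw [himg, hs]
    simp
  refine ⟨fun r => seqEntry s (r - u), hmono, himg', ?_⟩
  set c' := fun r => seqEntry s (r - u) with hc'
  have hex : ∀ i : Finset.Ico u w, ∃ j : Finset.Ico u w, c' j = c i := by
    intro i
    have : c i ∈ c' '' Set.Ico u w := by
      rw [himg']
      exact ⟨i, Finset.mem_Ico.1 i.2, rfl⟩
    obtain ⟨j, hj, hj'⟩ := this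
    exact ⟨⟨j, Finset.mem_Ico.2 hj⟩, hj'⟩
  choose f hf using hex
  have hinj : Function.Injective f := by
    intro i j hij
    have : c i = c j := by rw [← hf, ← hf, hij]
    exact Subtype.ext (hc (Finset.mem_Ico.1 i.2) (Finset.mem_Ico.1 j.2) this)
  let π : Equiv.Perm (Finset.Ico u w) := Equiv.ofBijective f (Finite.injective_iff_bijective.1 hinj)
  refine ⟨Equiv.Perm.sign π, ?_⟩
  have h := Matrix.det_permute' π (Matrix.of fun i j : Finset.Ico u w => N i (c' j))
  have e : (Matrix.of fun i j : Finset.Ico u w => N i (c' j)).submatrix id π =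
      Matrix.of fun i j : Finset.Ico u w => N i (c j) := by
    ext i j
    simp [π, hf]
  rw [e] at h
  unfold intervalMinor
  rw [h, Units.smul_def, zsmul_eq_mul]

/-- Replacing entries of an increasing sequence from the place `p` on, at least one of them by an
entry smaller than the one at `p`, gives a lexicographically smaller sequence after sorting. -/
theorem lex_lt_of_exchange {u w p : ℕ} {σ c c' : ℕ → ℕ} (hp : p ∈ Set.Ico u w)
    (hσ : StrictMonoOn σ (Set.Ico u w)) (hc : Set.InjOn c (Set.Ico u w))
    (hc' : StrictMonoOn c' (Set.Ico u w)) (himg : c' '' Set.Ico u w = c '' Set.Ico u w)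
    (hlow : ∀ r ∈ Set.Ico u p, c r = σ r) (hx : ∃ r ∈ Set.Ico p w, c r < σ p) :
    ∃ r ∈ Set.Ico u w, (∀ t ∈ Set.Ico u r, c' t = σ t) ∧ c' r < σ r := by
  classical
  obtain ⟨hp1, hp2⟩ := hp
  obtain ⟨r₀, ⟨hr₀, hr₀'⟩, hx⟩ := hx
  have hxlow : ∀ t ∈ Set.Ico u w, c r₀ = σ t → False := by
    rintro t ⟨ht1, ht2⟩ h
    rcases lt_or_ge t p with htp | htp
    · rw [← hlow t ⟨ht1, htp⟩] at h
      have := hc ⟨by omega, hr₀'⟩ ⟨ht1, ht2⟩ h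
      omega
    · have := hσ.monotoneOn (a := p) (b := t) ⟨hp1, hp2⟩ ⟨ht1, ht2⟩ htp
      omega
  obtain ⟨t, ⟨ht1, ht2⟩, ht⟩ : c r₀ ∈ c' '' Set.Ico u w := by
    rw [himg]
    exact ⟨r₀, ⟨by omega, hr₀'⟩, rfl⟩
  have hne : ∃ r, r ∈ Set.Ico u w ∧ c' r ≠ σ r :=
    ⟨t, ⟨ht1, ht2⟩, fun h => hxlow t ⟨ht1, ht2⟩ (ht.symm.trans h)⟩
  obtain ⟨hr, hrne⟩ := Nat.find_spec hne
  have hmin : ∀ s ∈ Set.Ico u (Nat.find hne), c' s = σ s := by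
    rintro s ⟨hs1, hs2⟩
    by_contra h
    exact Nat.find_min hne hs2 ⟨⟨hs1, hs2.trans hr.2⟩, h⟩
  set r := Nat.find hne
  refine ⟨r, hr, hmin, lt_of_le_of_ne (not_lt.1 fun hlt => ?_) hrne⟩
  have hnot : ∀ s ∈ Set.Ico u w, c' s ≠ σ r := by
    rintro s ⟨hs1, hs2⟩ h
    rcases lt_or_ge s r with hsr | hsr
    · rw [hmin s ⟨hs1, hsr⟩] at h
      have := hσ ⟨hs1, hs2⟩ hr hsr
      omega
    · have := hc'.monotoneOn hr ⟨hs1, hs2⟩ hsr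
      omega
  -- Suppose that at the first difference `r` the sorted sequence is larger. Then it skips `σ r`, so
  -- `r` is not among the untouched places below `p`. The new small entry now has no place: before
  -- `r` it would be an old entry, and from `r` on the entries exceed `σ r ≥ σ p`.
  have hpr : p ≤ r := by
    by_contra! h
    have : σ r ∈ c' '' Set.Ico u w := by
      rw [himg]
      exact ⟨r, hr, hlow r ⟨hr.1, h⟩⟩
    obtain ⟨s, hs, hs'⟩ := this
    exact hnot s hs hs'
  rcases lt_or_ge t r with htr | htr
  · exact hxlow t ⟨ht1, ht2⟩ (ht.symm.trans (hmin t ⟨ht1, htr⟩))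
  · have h1 := hc'.monotoneOn hr ⟨ht1, ht2⟩ htr
    have h2 := hσ.monotoneOn ⟨hp1, hp2⟩ hr hpr
    omega

end Sorting

end StaircaseMinor

namespace StaircaseMinor

open MvPolynomial

/-! ### Straightening in a family of interval minors -/

/-- The rows of a disjoint union of two adjacent intervals. -/
def sumIcoVal {u m w : ℕ} : Finset.Ico u m ⊕ Finset.Ico m w → ℕ :=
  Sum.elim (fun i => i) (fun i => i)

theorem sumIcoVal_mem {u m w : ℕ} (h₁ : u ≤ m) (h₂ : m ≤ w)
    (i : Finset.Ico u m ⊕ Finset.Ico m w) : sumIcoVal i ∈ Finset.Ico u w := by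
  rcases i with ⟨i, hi⟩ | ⟨i, hi⟩ <;>
  simp only [sumIcoVal, Sum.elim_inl, Sum.elim_inr, Finset.mem_Ico] at hi ⊢ <;> omega

/-- The disjoint union of two adjacent intervals is an interval. -/
noncomputable def sumIcoEquiv {u m w : ℕ} (h₁ : u ≤ m) (h₂ : m ≤ w) :
    Finset.Ico u m ⊕ Finset.Ico m w ≃ Finset.Ico u w :=
  Equiv.ofBijective (fun i => ⟨sumIcoVal i, sumIcoVal_mem h₁ h₂ i⟩) (by
    constructor
    · rintro (⟨i, hi⟩ | ⟨i, hi⟩) (⟨j, hj⟩ | ⟨j, hj⟩) h <;>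
      simp only [sumIcoVal, Sum.elim_inl, Sum.elim_inr, Finset.mem_Ico, Subtype.mk.injEq] at hi hj h
      · subst h; rfl
      · omega
      · omega
      · subst h; rfl
    · rintro ⟨i, hi⟩
      rw [Finset.mem_Ico] at hi
      rcases lt_or_ge i m with h | h
      · exact ⟨Sum.inl ⟨i, Finset.mem_Ico.2 ⟨hi.1, h⟩⟩, rfl⟩
      · exact ⟨Sum.inr ⟨i, Finset.mem_Ico.2 ⟨h, hi.2⟩⟩, rfl⟩)

/-- Translates between the index types split at a row, which the exchange relation needs, and the
intervals of rows. -/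
theorem det_sum_eq_intervalMinor {R : Type*} [CommRing R] (N : ℕ → ℕ → R) {u m w : ℕ} (h₁ : u ≤ m)
    (h₂ : m ≤ w) (c : ℕ → ℕ) (g : Finset.Ico u m ⊕ Finset.Ico m w → ℕ)
    (hg : ∀ i, g i = c (sumIcoVal i)) :
    (Matrix.of fun i j => N (sumIcoVal i) (g j)).det = intervalMinor N u w c := by
  rw [intervalMinor, ← Matrix.det_submatrix_equiv_self (sumIcoEquiv h₁ h₂)]
  congr 1
  ext i j : 2
  simp only [Matrix.of_apply, Matrix.submatrix_apply, hg]
  rfl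

/-- A family of interval minors of a generic staircase matrix, such that all the intervals of rows
contain a common row and are totally ordered by their two ends, and such that for each of the
intervals all the nonzero minors with these rows belong to the family. -/
structure MinorSystem (V : Type*) where
  S : ℕ → ℕ → Prop
  stair : IsStair S
  u : V → ℕ
  w : V → ℕ
  e : V → ℕ → ℕ
  core : ℕ
  u_le_core : ∀ p, u p ≤ core
  core_lt_w : ∀ p, core < w p
  total : ∀ p q, (u q ≤ u p ∧ w q ≤ w p) ∨ (u p ≤ u q ∧ w p ≤ w q)
  strictMono : ∀ p, StrictMonoOn (e p) (Set.Ico (u p) (w p))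
  ext : ∀ p q, u p = u q → w p = w q → (∀ r ∈ Set.Ico (u p) (w p), e p r = e q r) → p = q
  ne_zero : ∀ p, intervalMinor (genericMatrix S) (u p) (w p) (e p) ≠ 0
  exists_var : ∀ p c, StrictMonoOn c (Set.Ico (u p) (w p)) →
    intervalMinor (genericMatrix S) (u p) (w p) c ≠ 0 →
    ∃ q, u q = u p ∧ w q = w p ∧ ∀ r ∈ Set.Ico (u p) (w p), e q r = c r

namespace MinorSystem

variable {V : Type*} (A : MinorSystem V)

/-- The minor that belongs to an index. -/
noncomputable def minor (p : V) : MvPolynomial (ℕ × ℕ) ℂ :=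
  intervalMinor (genericMatrix A.S) (A.u p) (A.w p) (A.e p)

/-- The entries are weakly increasing in the common rows, and the interval of rows of the second
minor ends and begins earlier. -/
def le (p q : V) : Prop :=
  A.u q ≤ A.u p ∧ A.w q ≤ A.w p ∧ ∀ r ∈ Set.Ico (A.u p) (A.w q), A.e p r ≤ A.e q r

/-- Comparison of the intervals of rows, and lexicographic comparison for equal intervals. -/
def lt (p q : V) : Prop :=
  (A.u q ≤ A.u p ∧ A.w q ≤ A.w p ∧ ¬ (A.u q = A.u p ∧ A.w q = A.w p)) ∨
  (A.u q = A.u p ∧ A.w q = A.w p ∧ ∃ r ∈ Set.Ico (A.u p) (A.w p),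
    (∀ t ∈ Set.Ico (A.u p) r, A.e p t = A.e q t) ∧ A.e p r < A.e q r)

/-- An incomparable product is a combination of products with a smaller factor. -/
theorem minor_mul_mem_span {p q : V} (hu : A.u q ≤ A.u p) (hw : A.w q ≤ A.w p) {r₀ : ℕ}
    (hr₀ : r₀ ∈ Set.Ico (A.u p) (A.w q)) (hlt : A.e q r₀ < A.e p r₀) :
    A.minor p * A.minor q ∈
      Submodule.span ℂ {x | ∃ p' q', A.lt p' p ∧ x = A.minor p' * A.minor q'} := by
  classical
  obtain ⟨h1, h2⟩ := hr₀
  -- The columns to be exchanged: those of `p` from `r₀` on and those of `q` up to and including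
  -- `r₀`. Counting `r₀` on both sides produces the one surplus column.
  let X₁ := Finset.Ico r₀ (A.w p)
  let X₂ := Finset.Ico (A.u q) (r₀ + 1)
  let N := genericMatrix A.S
  let cP : Finset.Ico (A.u p) r₀ → ℕ := fun i => A.e p i
  let cQ : Finset.Ico (r₀ + 1) (A.w q) → ℕ := fun i => A.e q i
  let cA : (X₂ ⊕ X₁ → ℕ) → ℕ → ℕ := fun v r =>
    if h : r ∈ X₁ then v (Sum.inr ⟨r, h⟩) else A.e p r
  let cB : (X₂ ⊕ X₁ → ℕ) → ℕ → ℕ := fun v r =>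
    if h : r ∈ X₂ then v (Sum.inl ⟨r, h⟩) else A.e q r
  have hcA : ∀ v r (h : r ∈ X₁), cA v r = v (Sum.inr ⟨r, h⟩) := fun _ _ h => dif_pos h
  have hcB : ∀ v r (h : r ∈ X₂), cB v r = v (Sum.inl ⟨r, h⟩) := fun _ _ h => dif_pos h
  let w₀ : X₂ ⊕ X₁ → ℕ := Sum.elim (fun i => A.e q i) (fun i => A.e p i)
  have hprod : ∀ v, minorProd N sumIcoVal sumIcoVal cP cQ v =
      intervalMinor N (A.u p) (A.w p) (cA v) * intervalMinor N (A.u q) (A.w q) (cB v) := by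
    intro v
    unfold minorProd
    rw [det_sum_eq_intervalMinor N h1 (h2.le.trans hw) (cA v), det_sum_eq_intervalMinor N
      (by omega) (by omega) (cB v)]
    · rintro (⟨i, hi⟩ | ⟨i, hi⟩)
      · exact (hcB v i hi).symm
      · have : i ∉ X₂ := by
          simp only [X₂, Finset.mem_Ico] at hi ⊢
          omega
        simp [cB, sumIcoVal, this, cQ]
    · rintro (⟨i, hi⟩ | ⟨i, hi⟩)
      · have : i ∉ X₁ := by
          simp only [X₁, Finset.mem_Ico] at hi ⊢
          omega
        simp [cA, sumIcoVal, this, cP]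
      · exact (hcA v i hi).symm
  have hw₀ : minorProd N sumIcoVal sumIcoVal cP cQ w₀ = A.minor p * A.minor q := by
    rw [hprod]
    congr 1
    · refine intervalMinor_congr _ fun r _ => ?_
      simp only [cA, w₀]
      split_ifs <;> simp
    · refine intervalMinor_congr _ fun r _ => ?_
      simp only [cB, w₀]
      split_ifs <;> simp
  rw [← hw₀]
  refine minorProd_mem_of_exchange N _ _ cP cQ w₀ (Finset.Ico (A.u q) (A.w p)) ?_ ?_ ?_ _ ?_
  -- The number of exchanged columns is `(w p - r₀) + (r₀ + 1 - u q)`, one more than the `w p - u q`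
  -- rows of the union of the two intervals.
  · simp only [X₁, X₂, Fintype.card_sum, Fintype.card_coe, Nat.card_Ico]
    omega
  · intro i
    have := sumIcoVal_mem h1 (h2.le.trans hw) i
    rw [Finset.mem_Ico] at this ⊢
    omega
  · intro i
    have := sumIcoVal_mem (show A.u q ≤ r₀ + 1 by omega) (show r₀ + 1 ≤ A.w q by omega) i
    rw [Finset.mem_Ico] at this ⊢
    omega
  · rintro π ⟨x, y, hxy⟩
    rw [hprod]
    set v : X₂ ⊕ X₁ → ℕ := fun x => w₀ (π x)
    by_cases hA : Set.InjOn (cA v) (Set.Ico (A.u p) (A.w p))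
    swap
    · rw [intervalMinor_eq_zero_of_not_injOn N hA, zero_mul]
      exact Submodule.zero_mem _
    by_cases hB : Set.InjOn (cB v) (Set.Ico (A.u q) (A.w q))
    swap
    · rw [intervalMinor_eq_zero_of_not_injOn N hB, mul_zero]
      exact Submodule.zero_mem _
    obtain ⟨c, hc, hcimg, ε, hε⟩ := exists_sorted_intervalMinor N hA
    obtain ⟨d, hd, -, η, hη⟩ := exists_sorted_intervalMinor N hB
    by_cases hcz : intervalMinor N (A.u p) (A.w p) c = 0
    · rw [hε, hcz, smul_zero, zero_mul]
      exact Submodule.zero_mem _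
    by_cases hdz : intervalMinor N (A.u q) (A.w q) d = 0
    · rw [hη, hdz, smul_zero, mul_zero]
      exact Submodule.zero_mem _
    obtain ⟨p', hp'u, hp'w, hp'⟩ := A.exists_var p c hc hcz
    obtain ⟨q', hq'u, hq'w, hq'⟩ := A.exists_var q d hd hdz
    have hmp : A.minor p' = intervalMinor N (A.u p) (A.w p) c := by
      rw [minor, hp'u, hp'w]
      exact intervalMinor_congr _ fun r hr => hp' r (Finset.mem_Ico.1 hr)
    have hmq : A.minor q' = intervalMinor N (A.u q) (A.w q) d := by
      rw [minor, hq'u, hq'w]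
      exact intervalMinor_congr _ fun r hr => hq' r (Finset.mem_Ico.1 hr)
    rw [hε, hη, ← hmp, ← hmq, smul_mul_smul_comm, Units.smul_def]
    suffices hlt' : A.lt p' p by
      have hmem : A.minor p' * A.minor q' ∈
          {x | ∃ p' q', A.lt p' p ∧ x = A.minor p' * A.minor q'} := ⟨p', q', hlt', rfl⟩
      exact zsmul_mem (Submodule.subset_span hmem) _
    refine Or.inr ⟨hp'u.symm, hp'w.symm, ?_⟩
    have hlow : ∀ r ∈ Set.Ico (A.u p) r₀, cA v r = A.e p r := fun r hr => dif_neg (by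
      rw [Finset.mem_Ico]
      exact fun h => absurd hr.2 (not_lt.2 h.1))
    have hx : ∃ r ∈ Set.Ico r₀ (A.w p), cA v r < A.e p r₀ := by
      refine ⟨x, Finset.mem_Ico.1 x.2, ?_⟩
      have hy := Finset.mem_Ico.1 y.2
      -- The column received by the first minor comes from a place of `q` at or before `r₀`, hence
      -- is at most `e q r₀ < e p r₀`.
      have h3 : cA v x = A.e q y := by
        simp [cA, v, w₀, hxy]
      rw [h3]
      exact lt_of_le_of_lt ((A.strictMono q).monotoneOn ⟨hy.1, by omega⟩ ⟨by omega, h2⟩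
        (by omega)) hlt
    obtain ⟨r, hr, hrt, hrlt⟩ := lex_lt_of_exchange ⟨h1, h2.trans_le hw⟩ (A.strictMono p)
      hA hc hcimg hlow hx
    rw [hp'u, hp'w]
    refine ⟨r, hr, fun t ht => ?_, ?_⟩
    · rw [hp' t ⟨ht.1, ht.2.trans hr.2⟩, hrt t ht]
    · rw [hp' r hr]
      exact hrlt

theorem lt_irrefl (p : V) : ¬ A.lt p p := by
  rintro (⟨-, -, h⟩ | ⟨-, -, r, -, -, h⟩)
  · exact h ⟨rfl, rfl⟩
  · exact absurd h (_root_.lt_irrefl _)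

theorem lt_trans {p q s : V} (hpq : A.lt p q) (hqs : A.lt q s) : A.lt p s := by
  rcases hpq with ⟨h1, h2, h3⟩ | ⟨h1, h2, r, hr, hrt, hrlt⟩ <;>
  rcases hqs with ⟨k1, k2, k3⟩ | ⟨k1, k2, t, ht, htt, htlt⟩
  · exact Or.inl ⟨by omega, by omega, by omega⟩
  · exact Or.inl ⟨by omega, by omega, by omega⟩
  · exact Or.inl ⟨by omega, by omega, by omega⟩
  · refine Or.inr ⟨by omega, by omega, ?_⟩
    rw [h1, h2] at ht
    rw [h1] at htt
    rcases lt_trichotomy r t with hlt | rfl | hlt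
    · exact ⟨r, hr, fun x hx => (hrt x hx).trans (htt x ⟨hx.1, hx.2.trans hlt⟩),
        by rw [← htt r ⟨hr.1, hlt⟩]; exact hrlt⟩
    · exact ⟨r, hr, fun x hx => (hrt x hx).trans (htt x hx), hrlt.trans htlt⟩
    · exact ⟨t, ht, fun x hx => (hrt x ⟨hx.1, hx.2.trans hlt⟩).trans (htt x hx),
        by rw [hrt t ⟨ht.1, hlt⟩]; exact htlt⟩

/-- For different intervals the comparison is supplied by `total`; for equal intervals, the first
row in which the entries differ decides, and `ext` excludes that there is none. -/
theorem lt_trichotomy (p q : V) : A.lt p q ∨ p = q ∨ A.lt q p := by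
  by_cases hI : A.u q = A.u p ∧ A.w q = A.w p
  · by_cases hne : ∃ r, r ∈ Set.Ico (A.u p) (A.w p) ∧ A.e p r ≠ A.e q r
    · classical
      obtain ⟨hr, hrne⟩ := Nat.find_spec hne
      have hmin : ∀ s ∈ Set.Ico (A.u p) (Nat.find hne), A.e p s = A.e q s := by
        rintro s ⟨hs1, hs2⟩
        by_contra h
        exact Nat.find_min hne hs2 ⟨⟨hs1, hs2.trans hr.2⟩, h⟩
      rcases lt_or_gt_of_ne hrne with h | h
      · exact Or.inl (Or.inr ⟨hI.1, hI.2, _, hr, hmin, h⟩)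
      · refine Or.inr (Or.inr (Or.inr ⟨hI.1.symm, hI.2.symm, ?_⟩))
        rw [hI.1, hI.2]
        exact ⟨_, hr, fun t ht => (hmin t ht).symm, h⟩
    · push Not at hne
      exact Or.inr (Or.inl (A.ext p q hI.1.symm hI.2.symm hne))
  · rcases A.total p q with h | h
    · exact Or.inl (Or.inl ⟨h.1, h.2, hI⟩)
    · exact Or.inr (Or.inr (Or.inl ⟨h.1, h.2, fun hh => hI ⟨hh.1.symm, hh.2.symm⟩⟩))

/-- The product of two factors which are not comparable is a combination of products with a
factor smaller than both. -/
theorem minor_mul_mem_span_of_not_le {p q : V} (hpq : A.lt p q) (hle : ¬ A.le p q) :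
    A.minor p * A.minor q ∈
      Submodule.span ℂ {x | ∃ p' q', A.lt p' p ∧ x = A.minor p' * A.minor q'} := by
  have hI : A.u q ≤ A.u p ∧ A.w q ≤ A.w p := by
    rcases hpq with h | h <;> omega
  have : ∃ r ∈ Set.Ico (A.u p) (A.w q), A.e q r < A.e p r := by
    by_contra! h
    exact hle ⟨hI.1, hI.2, h⟩
  obtain ⟨r, hr, hlt⟩ := this
  exact A.minor_mul_mem_span hI.1 hI.2 hr hlt

theorem le_refl (p : V) : A.le p p := ⟨_root_.le_refl _, _root_.le_refl _, fun _ _ => _root_.le_refl _⟩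

theorem le_trans {p q s : V} (h : A.le p q) (h' : A.le q s) : A.le p s := by
  refine ⟨h'.1.trans h.1, h'.2.1.trans h.2.1, fun r hr => ?_⟩
  exact (h.2.2 r ⟨hr.1, hr.2.trans_le h'.2.1⟩).trans (h'.2.2 r ⟨h.1.trans hr.1, hr.2⟩)

theorem exists_least {s : Finset V} (hs : s.Nonempty) (hc : IsChain A.le (s : Set V)) :
    ∃ p ∈ s, ∀ q ∈ s, A.le p q := by
  classical
  induction hs using Finset.Nonempty.cons_induction with
  | singleton a => exact ⟨a, by simp, fun q hq => by rw [Finset.mem_singleton.1 hq]; exact A.le_refl a⟩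
  | cons a s ha hs ih =>
    obtain ⟨p, hp, hmin⟩ := ih (hc.mono (by simp))
    have hap : A.le a p ∨ A.le p a :=
      hc (by simp) (by simp [hp]) fun h => ha (h ▸ hp)
    rcases hap with h | h
    · refine ⟨a, by simp, fun q hq => ?_⟩
      rcases Finset.mem_cons.1 hq with rfl | hq
      · exact A.le_refl _
      · exact A.le_trans h (hmin q hq)
    · refine ⟨p, by simp [hp], fun q hq => ?_⟩
      rcases Finset.mem_cons.1 hq with rfl | hq
      · exact h
      · exact hmin q hq

/-! ### Recovering a chain from its leading exponent -/

/-- The leading exponent of the product of the minors in a monomial. -/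
noncomputable def leadExp : (V →₀ ℕ) →ₗ[ℕ] (ℕ × ℕ →₀ ℕ) :=
  Finsupp.linearCombination ℕ fun p => diagExp (A.u p) (A.w p) (A.e p)

theorem hasLead_minor (p : V) : HasLead (A.minor p) (diagExp (A.u p) (A.w p) (A.e p)) :=
  hasLead_intervalMinor (A.strictMono p) fun _ hr =>
    diag_mem_of_intervalMinor_ne_zero A.stair (A.strictMono p) (A.ne_zero p) hr

theorem hasLead_aeval_monomial (m : V →₀ ℕ) :
    HasLead (aeval A.minor (monomial m (1 : ℂ))) (A.leadExp m) := by
  induction m using Finsupp.induction_linear with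
  | zero => simpa using hasLead_one
  | add f g hf hg =>
    rw [map_add, show monomial (f + g) (1 : ℂ) = monomial f 1 * monomial g 1 by
      rw [monomial_mul, one_mul], map_mul]
    exact hf.mul hg
  | single p n =>
    rw [← X_pow_eq_monomial, map_pow, aeval_X, leadExp, Finsupp.linearCombination_single]
    exact (A.hasLead_minor p).pow n

theorem leadExp_apply (m : V →₀ ℕ) (x : ℕ × ℕ) :
    A.leadExp m x = ∑ p ∈ m.support, m p * diagExp (A.u p) (A.w p) (A.e p) x := by
  rw [leadExp, Finsupp.linearCombination_apply, Finsupp.sum, Finsupp.finsetSum_apply]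
  rfl

theorem diagExp_apply_ne_zero {u w : ℕ} {c : ℕ → ℕ} {r k : ℕ} :
    diagExp u w c (r, k) ≠ 0 ↔ r ∈ Set.Ico u w ∧ c r = k := by
  classical
  rw [diagExp, Finsupp.finsetSum_apply, Ne, Finset.sum_eq_zero_iff]
  simp only [Finsupp.single_apply, Prod.mk.injEq, Finset.mem_Ico, Set.mem_Ico]
  constructor
  · intro h
    push Not at h
    obtain ⟨i, hi, hne⟩ := h
    have : i = r ∧ c i = k := by
      by_contra hh
      exact hne (if_neg hh)
    exact ⟨this.1 ▸ hi, this.1 ▸ this.2⟩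
  · rintro ⟨hr, hk⟩ h
    have := h r hr
    simp [hk] at this

theorem leadExp_ne_zero {m : V →₀ ℕ} {r k : ℕ} :
    A.leadExp m (r, k) ≠ 0 ↔ ∃ p ∈ m.support, r ∈ Set.Ico (A.u p) (A.w p) ∧ A.e p r = k := by
  rw [leadExp_apply, Ne, Finset.sum_eq_zero_iff]
  push Not
  refine exists_congr fun p => and_congr_right fun hp => ?_
  rw [← diagExp_apply_ne_zero, Ne, mul_eq_zero, not_or]
  exact and_iff_right (Finsupp.mem_support_iff.1 hp)

/-- The degree of a monomial in the variables of row `r`. -/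
noncomputable def rowDegree (r : ℕ) : (ℕ × ℕ →₀ ℕ) →ₗ[ℕ] ℕ :=
  Finsupp.linearCombination ℕ fun x => if x.1 = r then 1 else 0

theorem rowDegree_leadExp (r : ℕ) (m : V →₀ ℕ) :
    rowDegree r (A.leadExp m) =
      ∑ p ∈ m.support, m p * if r ∈ Finset.Ico (A.u p) (A.w p) then 1 else 0 := by
  rw [leadExp, Finsupp.linearCombination_apply, Finsupp.sum, map_sum]
  refine Finset.sum_congr rfl fun p _ => ?_
  rw [map_smul, smul_eq_mul]
  congr 1
  simp only [diagExp, map_sum, rowDegree, Finsupp.linearCombination_single]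
  simp

theorem rowDegree_leadExp_of_forall {r : ℕ} {m : V →₀ ℕ}
    (h : ∀ p ∈ m.support, A.u p ≤ r ∧ r < A.w p) :
    rowDegree r (A.leadExp m) = ∑ p ∈ m.support, m p := by
  rw [rowDegree_leadExp]
  refine Finset.sum_congr rfl fun p hp => ?_
  rw [if_pos (Finset.mem_Ico.2 (h p hp)), mul_one]

/-- The least element of a chain has the latest beginning and the latest end of rows. The latest end
is the last row met by the exponent. A row that is no later than the core is met by every variable
of the chain exactly when its degree equals the degree in the core row, which every variable meets;
this detects the latest beginning. -/
theorem least_bounds {m m' : V →₀ ℕ} (h : A.leadExp m = A.leadExp m') {p p' : V}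
    (hp : p ∈ m.support) (hmin : ∀ q ∈ m.support, A.le p q) (hp' : p' ∈ m'.support)
    (hmin' : ∀ q ∈ m'.support, A.le p' q) :
    A.w p ≤ A.w p' ∧ A.u p' ≤ A.u p := by
  constructor
  · have hpw := A.core_lt_w p
    have hpu := A.u_le_core p
    have h1 : A.leadExp m (A.w p - 1, A.e p (A.w p - 1)) ≠ 0 :=
      A.leadExp_ne_zero.2 ⟨p, hp, ⟨by omega, by omega⟩, rfl⟩
    rw [h] at h1
    obtain ⟨q, hq, ⟨-, hqw⟩, -⟩ := A.leadExp_ne_zero.1 h1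
    have := (hmin' q hq).2.1
    omega
  · by_contra! hlt
    have hpu := A.u_le_core p
    have h1 : rowDegree (A.u p) (A.leadExp m) = rowDegree A.core (A.leadExp m) := by
      rw [A.rowDegree_leadExp_of_forall fun q _ => ⟨A.u_le_core q, A.core_lt_w q⟩,
        A.rowDegree_leadExp_of_forall fun q hq => ⟨(hmin q hq).1, hpu.trans_lt (A.core_lt_w q)⟩]
    rw [h, A.rowDegree_leadExp_of_forall fun q _ => ⟨A.u_le_core q, A.core_lt_w q⟩,
      rowDegree_leadExp] at h1
    refine absurd h1 (ne_of_lt (Finset.sum_lt_sum (fun q _ => ?_) ⟨p', hp', ?_⟩))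
    · split_ifs <;> simp
    · rw [if_neg (by rw [Finset.mem_Ico]; omega), mul_zero]
      exact Nat.pos_of_ne_zero (Finsupp.mem_support_iff.1 hp')

/-- In each of its rows the least element has the smallest column of the whole chain, and the
leading exponent records which columns occur in a row. -/
theorem least_entry_le {m m' : V →₀ ℕ} (h : A.leadExp m = A.leadExp m') {p p' : V}
    (hp : p ∈ m.support) (hmin' : ∀ q ∈ m'.support, A.le p' q) (hu : A.u p = A.u p') {r : ℕ}
    (hr : r ∈ Set.Ico (A.u p) (A.w p)) : A.e p' r ≤ A.e p r := by
  have h1 : A.leadExp m (r, A.e p r) ≠ 0 := A.leadExp_ne_zero.2 ⟨p, hp, hr, rfl⟩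
  rw [h] at h1
  obtain ⟨q, hq, ⟨-, hqw⟩, hqe⟩ := A.leadExp_ne_zero.1 h1
  rw [← hqe]
  exact (hmin' q hq).2.2 r ⟨hu ▸ hr.1, hqw⟩

theorem least_eq {m m' : V →₀ ℕ} (h : A.leadExp m = A.leadExp m') {p p' : V}
    (hp : p ∈ m.support) (hmin : ∀ q ∈ m.support, A.le p q) (hp' : p' ∈ m'.support)
    (hmin' : ∀ q ∈ m'.support, A.le p' q) : p = p' := by
  obtain ⟨h1, h2⟩ := A.least_bounds h hp hmin hp' hmin'
  obtain ⟨h3, h4⟩ := A.least_bounds h.symm hp' hmin' hp hmin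
  have hu : A.u p = A.u p' := by omega
  have hw : A.w p = A.w p' := by omega
  refine A.ext p p' hu hw fun r hr => _root_.le_antisymm ?_ ?_
  · exact A.least_entry_le h.symm hp' hmin hu.symm (by rwa [← hu, ← hw])
  · exact A.least_entry_le h hp hmin' hu hr

theorem leadExp_eq_zero {m : V →₀ ℕ} (h : A.leadExp m = 0) : m = 0 := by
  by_contra hm
  obtain ⟨p, hp⟩ := Finsupp.support_nonempty_iff.2 hm
  have : A.leadExp m (A.core, A.e p A.core) ≠ 0 :=
    A.leadExp_ne_zero.2 ⟨p, hp, ⟨A.u_le_core p, A.core_lt_w p⟩, rfl⟩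
  rw [h] at this
  exact this rfl

/-- A monomial whose variables form a chain is determined by its leading exponent. -/
theorem eq_of_leadExp_eq {m m' : V →₀ ℕ} (hm : IsChain A.le (m.support : Set V))
    (hm' : IsChain A.le (m'.support : Set V)) (h : A.leadExp m = A.leadExp m') : m = m' := by
  classical
  induction hn : m.degree generalizing m m' with
  | zero =>
    rw [Finsupp.degree_eq_zero_iff] at hn
    subst hn
    rw [map_zero] at h
    exact (A.leadExp_eq_zero h.symm).symm
  | succ n ih =>
    have hm0 : m ≠ 0 := by
      rintro rfl
      simp at hn
    have hm0' : m' ≠ 0 := by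
      rintro rfl
      rw [map_zero] at h
      exact hm0 (A.leadExp_eq_zero h)
    obtain ⟨p, hp, hmin⟩ := A.exists_least (Finsupp.support_nonempty_iff.2 hm0) hm
    obtain ⟨p', hp', hmin'⟩ := A.exists_least (Finsupp.support_nonempty_iff.2 hm0') hm'
    obtain rfl := A.least_eq h hp hmin hp' hmin'
    have hsub : ∀ k : V →₀ ℕ, p ∈ k.support → ∃ k', k = Finsupp.single p 1 + k' := by
      intro k hk
      refine ⟨k - Finsupp.single p 1, (add_tsub_cancel_of_le ?_).symm⟩
      rw [Finsupp.single_le_iff]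
      exact Nat.one_le_iff_ne_zero.2 (Finsupp.mem_support_iff.1 hk)
    obtain ⟨k, rfl⟩ := hsub m hp
    obtain ⟨k', rfl⟩ := hsub m' hp'
    have hmono : ∀ k : V →₀ ℕ, k.support ⊆ (Finsupp.single p 1 + k).support := by
      intro k x hx
      rw [Finsupp.mem_support_iff] at hx ⊢
      rw [Finsupp.add_apply]
      omega
    rw [ih (m := k) (m' := k') (hm.mono (by exact_mod_cast hmono k))
      (hm'.mono (by exact_mod_cast hmono k'))]
    · rw [map_add, map_add] at h
      exact add_left_cancel h
    · rw [map_add, Finsupp.degree_single] at hn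
      omega

theorem linearIndependent_chain :
    LinearIndependent ℂ fun m : {m : V →₀ ℕ // IsChain A.le (m.support : Set V)} =>
      aeval A.minor (monomial m.1 (1 : ℂ)) :=
  linearIndependent_of_hasLead (d := fun m => A.leadExp m.1)
    (fun m m' h => Subtype.ext (A.eq_of_leadExp_eq m.2 m'.2 h))
    fun m => A.hasLead_aeval_monomial m.1

end MinorSystem

end StaircaseMinor

/-! ### Combinatorics of `Y`-shaped quivers -/

namespace DimQuiver

variable {ρ : ℕ} {Q : DimQuiver ρ}

theorem IsQuiverFlag.lt_of_arrow (hQ : Q.IsQuiverFlag) {i j : Fin (ρ + 1)} (h : Q.n i j ≠ 0) :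
    i < j := by
  by_contra! hji
  exact h (hQ.acyclic i j hji)

theorem IsQuiverFlag.le_of_reaches (hQ : Q.IsQuiverFlag) {i j : Fin (ρ + 1)} (h : Q.Reaches i j) :
    i ≤ j := by
  induction h with
  | refl => exact le_rfl
  | tail _ h ih => exact ih.trans (hQ.lt_of_arrow h).le

theorem IsYShaped.one_ne_zero (hY : Q.IsYShaped) : (1 : Fin (ρ + 1)) ≠ 0 := by
  have := hY.one_le
  intro h
  have h1 := congrArg Fin.val h
  rw [Fin.val_one', Fin.val_zero, Nat.mod_eq_of_lt (by omega)] at h1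
  omega

theorem IsYShaped.one_le_of_ne_zero (hY : Q.IsYShaped) {i : Fin (ρ + 1)} (h : i ≠ 0) : 1 ≤ i := by
  have := hY.one_le
  rw [Fin.le_def, Fin.val_one', Nat.mod_eq_of_lt (by omega)]
  exact Nat.one_le_iff_ne_zero.2 fun h0 => h (Fin.ext h0)

theorem IsYShaped.pos_of_one_le (hY : Q.IsYShaped) {i : Fin (ρ + 1)} (h : 1 ≤ i) : i ≠ 0 := by
  rintro rfl
  exact hY.one_ne_zero (le_antisymm h (Fin.zero_le _))

/-- The only contribution of vertices different from the source comes from the predecessor. -/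
theorem IsYShaped.sum_erase_eq (hY : Q.IsYShaped) {i j : Fin (ρ + 1)} (hi : i ≠ 0)
    (h : Q.n i j ≠ 0) (f : Fin (ρ + 1) → ℕ) :
    ∑ l ∈ Finset.univ.erase 0, Q.n l j * f l = f i := by
  have hle := hY.in_le j
  have hmem : i ∈ Finset.univ.erase (0 : Fin (ρ + 1)) := by simp [hi]
  rw [← Finset.add_sum_erase _ _ hmem] at hle
  rw [← Finset.add_sum_erase _ _ hmem, Finset.sum_eq_zero, show Q.n i j = 1 by omega]
  · omega
  · intro l hl
    have := Finset.single_le_sum (f := fun l => Q.n l j) (fun _ _ => Nat.zero_le _) hl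
    rw [show Q.n l j = 0 by omega, zero_mul]

theorem IsYShaped.pred_unique (hY : Q.IsYShaped) {i i' j : Fin (ρ + 1)} (hi : i ≠ 0)
    (hi' : i' ≠ 0) (h : Q.n i j ≠ 0) (h' : Q.n i' j ≠ 0) : i = i' := by
  have := (hY.sum_erase_eq hi h fun l => l.val).symm.trans (hY.sum_erase_eq hi' h' fun l => l.val)
  exact Fin.ext this

theorem IsYShaped.succ_unique (hY : Q.IsYShaped) {i j j' : Fin (ρ + 1)} (hi : i ≠ 0)
    (hi' : i ≠ 1) (h : Q.n i j ≠ 0) (h' : Q.n i j' ≠ 0) : j = j' := by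
  by_contra hne
  have h1 := hY.out_le i hi hi'
  rw [← Finset.add_sum_erase _ _ (Finset.mem_univ j)] at h1
  have := Finset.single_le_sum (f := fun l => Q.n i l) (fun _ _ => Nat.zero_le _)
    (show j' ∈ Finset.univ.erase j by simp [Ne.symm hne])
  omega

theorem s_eq (i : Fin (ρ + 1)) :
    Q.s i = Q.n 0 i * Q.r 0 + ∑ l ∈ Finset.univ.erase 0, Q.n l i * Q.r l := by
  rw [s, ← Finset.add_sum_erase _ _ (Finset.mem_univ 0)]

theorem sTilde_zero : Q.sTilde 0 = 1 := by
  rw [sTilde, if_pos rfl]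

theorem IsQuiverFlag.sTilde_eq (hQ : Q.IsQuiverFlag) {i : Fin (ρ + 1)} (hi : i ≠ 0) :
    Q.sTilde i = Q.n 0 i + ∑ l ∈ Finset.univ.erase 0, Q.n l i * Q.sTilde l := by
  rw [sTilde, if_neg hi]
  have h : ∑ j : Fin i.val, Q.n ⟨j.val, j.isLt.trans i.isLt⟩ i *
      Q.sTilde ⟨j.val, j.isLt.trans i.isLt⟩ = ∑ l, Q.n l i * Q.sTilde l := by
    refine Fintype.sum_of_injective (fun j : Fin i.val => (⟨j.val, j.isLt.trans i.isLt⟩ :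
      Fin (ρ + 1))) (fun a b hab => ?_) _ _ (fun l hl => ?_) (fun _ => rfl)
    · simpa [Fin.ext_iff] using hab
    · rw [hQ.acyclic l i, zero_mul]
      by_contra! hlt
      exact hl ⟨⟨l.val, hlt⟩, rfl⟩
  rw [h, ← Finset.add_sum_erase _ _ (Finset.mem_univ 0), sTilde_zero, mul_one]

theorem IsQuiverFlag.n_one (hQ : Q.IsQuiverFlag) (hY : Q.IsYShaped) {l : Fin (ρ + 1)}
    (hl : l ∈ Finset.univ.erase (0 : Fin (ρ + 1))) : Q.n l 1 = 0 :=
  hQ.acyclic l 1 (hY.one_le_of_ne_zero (Finset.ne_of_mem_erase hl))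

theorem IsQuiverFlag.kPrev_one (hQ : Q.IsQuiverFlag) (hY : Q.IsYShaped) : Q.kPrev 1 = 0 :=
  Finset.sum_eq_zero fun l hl => by rw [hQ.n_one hY hl, zero_mul]

theorem IsQuiverFlag.s_one (hQ : Q.IsQuiverFlag) (hY : Q.IsYShaped) : Q.s 1 = Q.sTilde 1 := by
  rw [s_eq, hQ.sTilde_eq hY.one_ne_zero, hQ.r_zero, mul_one,
    Finset.sum_eq_zero fun l hl => by rw [hQ.n_one hY hl, zero_mul],
    Finset.sum_eq_zero fun l hl => by rw [hQ.n_one hY hl, zero_mul]]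

theorem IsYShaped.kPrev_eq (hY : Q.IsYShaped) {i j : Fin (ρ + 1)} (hi : i ≠ 0)
    (h : Q.n i j ≠ 0) : Q.kPrev j = Q.k i :=
  hY.sum_erase_eq hi h _

theorem IsQuiverFlag.s_eq_of_arrow (hQ : Q.IsQuiverFlag) (hY : Q.IsYShaped) {i j : Fin (ρ + 1)}
    (hi : i ≠ 0) (h : Q.n i j ≠ 0) : Q.s j = Q.n 0 j + Q.r i := by
  rw [s_eq, hQ.r_zero, mul_one, hY.sum_erase_eq hi h]

theorem IsQuiverFlag.sTilde_eq_of_arrow (hQ : Q.IsQuiverFlag) (hY : Q.IsYShaped)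
    {i j : Fin (ρ + 1)} (hi : i ≠ 0) (h : Q.n i j ≠ 0) :
    Q.sTilde j = Q.n 0 j + Q.sTilde i := by
  have hj : j ≠ 0 := by
    rintro rfl
    exact h (hQ.acyclic _ _ (Fin.zero_le _))
  rw [hQ.sTilde_eq hj, hY.sum_erase_eq hi h]

/-- A path that starts at a vertex different from the source and is not trivial has a last arrow. -/
theorem IsQuiverFlag.exists_pred (hQ : Q.IsQuiverFlag) {i j : Fin (ρ + 1)} (hi : i ≠ 0)
    (h : Q.Reaches i j) (hij : i ≠ j) : ∃ l, l ≠ 0 ∧ Q.Reaches i l ∧ Q.n l j ≠ 0 := by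
  rcases Relation.ReflTransGen.cases_tail h with h | ⟨l, hl, hlj⟩
  · exact absurd h.symm hij
  · refine ⟨l, ?_, hl, hlj⟩
    rintro rfl
    exact hi (le_antisymm (hQ.le_of_reaches hl) (Fin.zero_le _))

/-- Together with `r_i < s_i` this makes the truncated difference in the definition of `k` an honest
one. -/
theorem IsQuiverFlag.s_le_sTilde (hQ : Q.IsQuiverFlag) (hY : Q.IsYShaped) (i : Fin (ρ + 1))
    (hi : i ≠ 0) : Q.s i ≤ Q.sTilde i := by
  induction i using WellFoundedLT.induction with
  | ind i ih =>
    by_cases h1 : i = 1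
    · rw [h1, hQ.s_one hY]
    · obtain ⟨l, hl, -, hli⟩ := hQ.exists_pred hY.one_ne_zero (hY.path i hi h1) (Ne.symm h1)
      rw [hQ.s_eq_of_arrow hY hl hli, hQ.sTilde_eq_of_arrow hY hl hli]
      have := ih l (hQ.lt_of_arrow hli) hl
      have := hQ.r_lt_s l hl
      omega

/-- The rows of `A_i` are those which come from the predecessor and the new ones. -/
theorem IsQuiverFlag.kPrev_add (hQ : Q.IsQuiverFlag) (hY : Q.IsYShaped) {i : Fin (ρ + 1)}
    (hi : i ≠ 0) : Q.kPrev i + (Q.s i - Q.r i) = Q.k i := by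
  by_cases h1 : i = 1
  · rw [h1, hQ.kPrev_one hY, hQ.s_one hY, k, zero_add]
  · obtain ⟨l, hl, -, hli⟩ := hQ.exists_pred hY.one_ne_zero (hY.path i hi h1) (Ne.symm h1)
    rw [hY.kPrev_eq hl hli, hQ.s_eq_of_arrow hY hl hli, k, k, hQ.sTilde_eq_of_arrow hY hl hli]
    have h2 := hQ.s_le_sTilde hY l hl
    have h3 := hQ.r_lt_s l hl
    have h4 := hQ.r_lt_s i hi
    rw [hQ.s_eq_of_arrow hY hl hli] at h4
    omega

/-- Since `r_i < s_i`, each vertex brings at least one row of its own. This is what makes the sizes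
of the minors grow strictly along a branch. -/
theorem IsQuiverFlag.kPrev_lt (hQ : Q.IsQuiverFlag) (hY : Q.IsYShaped) {i : Fin (ρ + 1)}
    (hi : i ≠ 0) : Q.kPrev i < Q.k i := by
  have := hQ.kPrev_add hY hi
  have := hQ.r_lt_s i hi
  omega

theorem IsQuiverFlag.k_le_of_reaches (hQ : Q.IsQuiverFlag) (hY : Q.IsYShaped) {i j : Fin (ρ + 1)}
    (hi : i ≠ 0) (h : Q.Reaches i j) : Q.k i ≤ Q.k j ∧ Q.sTilde i ≤ Q.sTilde j := by
  induction h with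
  | refl => exact ⟨le_rfl, le_rfl⟩
  | @tail l j hl hlj ih =>
    have hl0 : l ≠ 0 := by
      rintro rfl
      exact hi (le_antisymm (hQ.le_of_reaches hl) (Fin.zero_le _))
    have hj0 : j ≠ 0 := by
      rintro rfl
      exact hlj (hQ.acyclic _ _ (Fin.zero_le _))
    have h1 := hQ.kPrev_lt hY hj0
    rw [hY.kPrev_eq hl0 hlj] at h1
    have h2 := hQ.sTilde_eq_of_arrow hY hl0 hlj
    omega

theorem IsQuiverFlag.k_le_kPrev (hQ : Q.IsQuiverFlag) (hY : Q.IsYShaped) {i j : Fin (ρ + 1)}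
    (hi : i ≠ 0) (h : Q.Reaches i j) (hij : i ≠ j) : Q.k i ≤ Q.kPrev j := by
  obtain ⟨l, hl, hil, hlj⟩ := hQ.exists_pred hi h hij
  rw [hY.kPrev_eq hl hlj]
  exact (hQ.k_le_of_reaches hY hi hil).1

/-- Beyond vertex 1 each vertex has at most one successor, so the paths that start there cannot
fork. -/
theorem IsQuiverFlag.reaches_total (hQ : Q.IsQuiverFlag) (hY : Q.IsYShaped) {h i i' : Fin (ρ + 1)}
    (h1 : 1 < h) (hi : Q.Reaches h i) (hi' : Q.Reaches h i') : Q.Reaches i i' ∨ Q.Reaches i' i := by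
  induction hi with
  | refl => exact Or.inl hi'
  | @tail l j hl hlj ih =>
    rcases ih with ih | ih
    · rcases Relation.ReflTransGen.cases_head ih with rfl | ⟨c, hc, hci⟩
      · exact Or.inr (Relation.ReflTransGen.single hlj)
      · have hlt := h1.trans_le (hQ.le_of_reaches hl)
        rw [hY.succ_unique (hY.pos_of_one_le hlt.le) hlt.ne' hlj hc]
        exact Or.inl hci
    · exact Or.inr (ih.tail hlj)

/-- The two branches are disjoint: predecessors other than the source are unique, so tracing back
from a common vertex leads to the same successor of 1. -/
theorem IsQuiverFlag.eq_of_reaches (hQ : Q.IsQuiverFlag) (hY : Q.IsYShaped)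
    {h h' i : Fin (ρ + 1)} (hh : Q.n 1 h ≠ 0) (hh' : Q.n 1 h' ≠ 0) (hi : Q.Reaches h i)
    (hi' : Q.Reaches h' i) : h = h' := by
  have h1 := hQ.lt_of_arrow hh
  have h1' := hQ.lt_of_arrow hh'
  have h0 := hY.pos_of_one_le h1.le
  have h0' := hY.pos_of_one_le h1'.le
  induction hi with
  | refl =>
    by_contra hne
    obtain ⟨l, hl, hl', hlh⟩ := hQ.exists_pred h0' hi' (Ne.symm hne)
    rw [hY.pred_unique hl hY.one_ne_zero hlh hh] at hl'
    exact absurd (hQ.le_of_reaches hl') (not_le.2 h1')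
  | @tail l j hl hlj ih =>
    have hl0 : l ≠ 0 := hY.pos_of_one_le (h1.le.trans (hQ.le_of_reaches hl))
    by_cases hj : h' = j
    · subst hj
      rw [hY.pred_unique hl0 hY.one_ne_zero hlj hh'] at hl
      exact absurd (hQ.le_of_reaches hl) (not_le.2 h1)
    · obtain ⟨m, hm, hm', hmj⟩ := hQ.exists_pred h0' hi' hj
      rw [hY.pred_unique hm hl0 hmj hlj] at hm'
      exact ih hm'

theorem IsQuiverFlag.coord_ne_zero (hQ : Q.IsQuiverFlag) (y : Q.Coord) : y.1 ≠ 0 := by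
  intro h
  have h1 := y.2.1.isLt
  have h2 : Q.s y.1 = 0 := Finset.sum_eq_zero fun j _ => by
    rw [h, hQ.acyclic j 0 (Fin.zero_le _), zero_mul]
  omega

/-! ### The two branches -/

namespace Branching

variable (B : Q.Branching)

theorem mem_S₁ {i : Fin (ρ + 1)} : i ∈ B.S₁ ↔ i = 1 ∨ i ∈ B.S₁' := Finset.mem_insert

theorem mem_S₂ {i : Fin (ρ + 1)} : i ∈ B.S₂ ↔ i = 1 ∨ i ∈ B.S₂' := Finset.mem_insert

theorem mem_S₁' {i : Fin (ρ + 1)} : i ∈ B.S₁' ↔ ∃ h, B.head₁ = some h ∧ Q.Reaches h i := by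
  simp [S₁']

theorem mem_S₂' {i : Fin (ρ + 1)} : i ∈ B.S₂' ↔ ∃ h, B.head₂ = some h ∧ Q.Reaches h i := by
  simp [S₂']

theorem mem_S₁_or_mem_S₂' (hY : Q.IsYShaped) {i : Fin (ρ + 1)} (hi : i ≠ 0) :
    i ∈ B.S₁ ∨ i ∈ B.S₂' := by
  rw [mem_S₁]
  by_cases h1 : i = 1
  · exact Or.inl (Or.inl h1)
  · rcases Relation.ReflTransGen.cases_head (hY.path i hi h1) with h | ⟨c, hc, hci⟩
    · exact absurd h.symm h1
    · rcases (B.isHead c).1 hc with h | h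
      · exact Or.inl (Or.inr (B.mem_S₁'.2 ⟨c, h, hci⟩))
      · exact Or.inr (B.mem_S₂'.2 ⟨c, h, hci⟩)

variable {B}

theorem one_lt_of_mem_S₁' (hQ : Q.IsQuiverFlag) {i : Fin (ρ + 1)} (hi : i ∈ B.S₁') : 1 < i := by
  obtain ⟨h, hh, hi⟩ := B.mem_S₁'.1 hi
  exact (hQ.lt_of_arrow ((B.isHead h).2 (Or.inl hh))).trans_le (hQ.le_of_reaches hi)

theorem one_lt_of_mem_S₂' (hQ : Q.IsQuiverFlag) {i : Fin (ρ + 1)} (hi : i ∈ B.S₂') : 1 < i := by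
  obtain ⟨h, hh, hi⟩ := B.mem_S₂'.1 hi
  exact (hQ.lt_of_arrow ((B.isHead h).2 (Or.inr hh))).trans_le (hQ.le_of_reaches hi)

theorem reaches_one_of_mem_S₁' {i : Fin (ρ + 1)} (hi : i ∈ B.S₁') : Q.Reaches 1 i := by
  obtain ⟨h, hh, hi⟩ := B.mem_S₁'.1 hi
  exact Relation.ReflTransGen.head ((B.isHead h).2 (Or.inl hh)) hi

theorem reaches_one_of_mem_S₂' {i : Fin (ρ + 1)} (hi : i ∈ B.S₂') : Q.Reaches 1 i := by
  obtain ⟨h, hh, hi⟩ := B.mem_S₂'.1 hi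
  exact Relation.ReflTransGen.head ((B.isHead h).2 (Or.inr hh)) hi

theorem notMem_S₁_of_mem_S₂' (hQ : Q.IsQuiverFlag) (hY : Q.IsYShaped) {i : Fin (ρ + 1)}
    (hi : i ∈ B.S₂') : i ∉ B.S₁ := by
  rw [mem_S₁]
  rintro (h | h)
  · exact absurd h (one_lt_of_mem_S₂' hQ hi).ne'
  · obtain ⟨a, ha, hai⟩ := B.mem_S₁'.1 h
    obtain ⟨b, hb, hbi⟩ := B.mem_S₂'.1 hi
    have := hQ.eq_of_reaches hY ((B.isHead a).2 (Or.inl ha)) ((B.isHead b).2 (Or.inr hb)) hai hbi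
    subst this
    exact B.distinct a ⟨ha, hb⟩

theorem reaches_of_le_of_reaches (hQ : Q.IsQuiverFlag) {i i' : Fin (ρ + 1)}
    (h : Q.Reaches i i' ∨ Q.Reaches i' i) (hle : i ≤ i') : Q.Reaches i i' := by
  rcases h with h | h
  · exact h
  · rw [le_antisymm hle (hQ.le_of_reaches h)]
    exact Relation.ReflTransGen.refl

theorem reaches_of_mem_S₁ (hQ : Q.IsQuiverFlag) (hY : Q.IsYShaped) {i i' : Fin (ρ + 1)}
    (hi : i ∈ B.S₁) (hi' : i' ∈ B.S₁) (hle : i ≤ i') : Q.Reaches i i' := by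
  refine reaches_of_le_of_reaches hQ ?_ hle
  rcases B.mem_S₁.1 hi with rfl | hi <;> rcases B.mem_S₁.1 hi' with rfl | hi'
  · exact Or.inl Relation.ReflTransGen.refl
  · exact Or.inl (reaches_one_of_mem_S₁' hi')
  · exact Or.inr (reaches_one_of_mem_S₁' hi)
  · obtain ⟨a, ha, hai⟩ := B.mem_S₁'.1 hi
    obtain ⟨b, hb, hbi⟩ := B.mem_S₁'.1 hi'
    obtain rfl : a = b := Option.some_injective _ (ha.symm.trans hb)
    exact hQ.reaches_total hY (hQ.lt_of_arrow ((B.isHead a).2 (Or.inl ha))) hai hbi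

theorem reaches_of_mem_S₂ (hQ : Q.IsQuiverFlag) (hY : Q.IsYShaped) {i i' : Fin (ρ + 1)}
    (hi : i ∈ B.S₂) (hi' : i' ∈ B.S₂) (hle : i ≤ i') : Q.Reaches i i' := by
  refine reaches_of_le_of_reaches hQ ?_ hle
  rcases B.mem_S₂.1 hi with rfl | hi <;> rcases B.mem_S₂.1 hi' with rfl | hi'
  · exact Or.inl Relation.ReflTransGen.refl
  · exact Or.inl (reaches_one_of_mem_S₂' hi')
  · exact Or.inr (reaches_one_of_mem_S₂' hi)
  · obtain ⟨a, ha, hai⟩ := B.mem_S₂'.1 hi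
    obtain ⟨b, hb, hbi⟩ := B.mem_S₂'.1 hi'
    obtain rfl : a = b := Option.some_injective _ (ha.symm.trans hb)
    exact hQ.reaches_total hY (hQ.lt_of_arrow ((B.isHead a).2 (Or.inr ha))) hai hbi

theorem ne_zero_of_mem_S₁ (hQ : Q.IsQuiverFlag) (hY : Q.IsYShaped) {i : Fin (ρ + 1)}
    (hi : i ∈ B.S₁) : i ≠ 0 := by
  rcases B.mem_S₁.1 hi with rfl | hi
  · exact hY.one_ne_zero
  · exact hY.pos_of_one_le (one_lt_of_mem_S₁' hQ hi).le

theorem ne_zero_of_mem_S₂ (hQ : Q.IsQuiverFlag) (hY : Q.IsYShaped) {i : Fin (ρ + 1)}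
    (hi : i ∈ B.S₂) : i ≠ 0 := by
  rcases B.mem_S₂.1 hi with rfl | hi
  · exact hY.one_ne_zero
  · exact hY.pos_of_one_le (one_lt_of_mem_S₂' hQ hi).le

theorem le_last₁ (hQ : Q.IsQuiverFlag) (hY : Q.IsYShaped) {i : Fin (ρ + 1)} (hi : i ∈ B.S₁) :
    Q.k i ≤ Q.k B.last₁ ∧ Q.sTilde i ≤ Q.sTilde B.last₁ :=
  hQ.k_le_of_reaches hY (ne_zero_of_mem_S₁ hQ hY hi)
    (reaches_of_mem_S₁ hQ hY hi (Finset.max'_mem _ _) (Finset.le_max' _ _ hi))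

theorem le_last₂ (hQ : Q.IsQuiverFlag) (hY : Q.IsYShaped) {i : Fin (ρ + 1)} (hi : i ∈ B.S₂) :
    Q.k i ≤ Q.k B.last₂ ∧ Q.sTilde i ≤ Q.sTilde B.last₂ :=
  hQ.k_le_of_reaches hY (ne_zero_of_mem_S₂ hQ hY hi)
    (reaches_of_mem_S₂ hQ hY hi (Finset.max'_mem _ _) (Finset.le_max' _ _ hi))

theorem one_le_kPrev_of_mem_S₁' (hQ : Q.IsQuiverFlag) (hY : Q.IsYShaped) {i : Fin (ρ + 1)}
    (hi : i ∈ B.S₁') : Q.k 1 ≤ Q.kPrev i ∧ Q.sTilde 1 ≤ Q.sTilde i :=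
  ⟨hQ.k_le_kPrev hY hY.one_ne_zero (reaches_one_of_mem_S₁' hi) (one_lt_of_mem_S₁' hQ hi).ne,
    (hQ.k_le_of_reaches hY hY.one_ne_zero (reaches_one_of_mem_S₁' hi)).2⟩

theorem one_le_kPrev_of_mem_S₂' (hQ : Q.IsQuiverFlag) (hY : Q.IsYShaped) {i : Fin (ρ + 1)}
    (hi : i ∈ B.S₂') : Q.k 1 ≤ Q.kPrev i ∧ Q.sTilde 1 ≤ Q.sTilde i :=
  ⟨hQ.k_le_kPrev hY hY.one_ne_zero (reaches_one_of_mem_S₂' hi) (one_lt_of_mem_S₂' hQ hi).ne,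
    (hQ.k_le_of_reaches hY hY.one_ne_zero (reaches_one_of_mem_S₂' hi)).2⟩

theorem one_mem_S₁ : 1 ∈ B.S₁ := B.mem_S₁.2 (Or.inl rfl)

theorem one_mem_S₂ : 1 ∈ B.S₂ := B.mem_S₂.2 (Or.inl rfl)

end Branching

end DimQuiver

/-! ### Gluing the two matrices along the rows of vertex 1 -/

namespace DimQuiver.Branching

open MvPolynomial StaircaseMinor

variable {ρ : ℕ} {Q : DimQuiver ρ} (B : Q.Branching)

/-- The number of rows of `M₁` above the rows shared with `M₂`. -/
noncomputable def base : ℕ := Q.k B.last₁ - Q.k 1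

/-- The number of rows above those of the vertex `i` in the matrix glued from `M₁` and `M₂`. -/
noncomputable def rowOffset (i : Fin (ρ + 1)) : ℕ :=
  if i ∈ B.S₁ then Q.k B.last₁ - Q.k i else B.base + Q.kPrev i

/-- The number of columns to the left of those of the vertex `i` in the glued matrix. -/
noncomputable def colOffset (i : Fin (ρ + 1)) : ℕ :=
  if i ∈ B.S₁ then Q.sTilde B.last₁ - Q.sTilde i else B.shift

/-- The place of a coordinate in the matrix glued from `M₁` and `M₂` along their common rows. -/
noncomputable def pos (y : Q.Coord) : ℕ × ℕ :=
  (B.rowOffset y.1 + y.2.1.val + 1, B.colOffset y.1 + y.2.2.val + 1)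

/-- The places of the coordinates. -/
def placed (p c : ℕ) : Prop := ∃ y, B.pos y = (p, c)

variable {B}

theorem bounds_of_mem_S₁ (hQ : Q.IsQuiverFlag) (hY : Q.IsYShaped) {i : Fin (ρ + 1)}
    (hi : i ∈ B.S₁) : Q.k 1 ≤ Q.k i ∧ Q.k i ≤ Q.k B.last₁ ∧ Q.sTilde 1 ≤ Q.sTilde i ∧
      Q.sTilde i ≤ Q.sTilde B.last₁ ∧ Q.kPrev i + (Q.s i - Q.r i) = Q.k i := by
  have h1 := le_last₁ hQ hY hi
  have h2 := hQ.k_le_of_reaches hY hY.one_ne_zero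
    (reaches_of_mem_S₁ hQ hY one_mem_S₁ hi
      (hY.one_le_of_ne_zero (ne_zero_of_mem_S₁ hQ hY hi)))
  exact ⟨h2.1, h1.1, h2.2, h1.2, hQ.kPrev_add hY (ne_zero_of_mem_S₁ hQ hY hi)⟩

theorem bounds_of_mem_S₂' (hQ : Q.IsQuiverFlag) (hY : Q.IsYShaped) {i : Fin (ρ + 1)}
    (hi : i ∈ B.S₂') : Q.k 1 ≤ Q.kPrev i ∧ Q.sTilde 1 ≤ Q.sTilde i ∧
      Q.sTilde i ≤ Q.sTilde B.last₂ ∧ Q.kPrev i + (Q.s i - Q.r i) = Q.k i := by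
  have h1 := one_le_kPrev_of_mem_S₂' hQ hY hi
  have h2 := B.mem_S₂.2 (Or.inr hi)
  exact ⟨h1.1, h1.2, (le_last₂ hQ hY h2).2, hQ.kPrev_add hY (ne_zero_of_mem_S₂ hQ hY h2)⟩

theorem offset_of_mem_S₁ {i : Fin (ρ + 1)} (hi : i ∈ B.S₁) :
    B.rowOffset i = Q.k B.last₁ - Q.k i ∧ B.colOffset i = Q.sTilde B.last₁ - Q.sTilde i :=
  ⟨if_pos hi, if_pos hi⟩

theorem offset_of_mem_S₂' (hQ : Q.IsQuiverFlag) (hY : Q.IsYShaped) {i : Fin (ρ + 1)}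
    (hi : i ∈ B.S₂') : B.rowOffset i = B.base + Q.kPrev i ∧ B.colOffset i = B.shift :=
  ⟨if_neg (notMem_S₁_of_mem_S₂' hQ hY hi), if_neg (notMem_S₁_of_mem_S₂' hQ hY hi)⟩

/-- The shared block occupies the rows `base + 1, …, base + k 1` and the columns `shift + 1, …,
shift + s̃_1`, which are the last ones of `M₁`. -/
theorem base_add (hQ : Q.IsQuiverFlag) (hY : Q.IsYShaped) :
    B.base + Q.k 1 = Q.k B.last₁ ∧ B.shift + Q.sTilde 1 = Q.sTilde B.last₁ := by
  have h := bounds_of_mem_S₁ hQ hY (B := B) one_mem_S₁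
  unfold base shift
  omega

theorem one_le_k_one (hQ : Q.IsQuiverFlag) (hY : Q.IsYShaped) : 1 ≤ Q.k 1 := by
  have := hQ.kPrev_lt hY hY.one_ne_zero
  omega

/-- The places of a row form an interval whose ends weakly increase with the row, and every row
meets the places of at most one vertex. -/
theorem block_mono (hQ : Q.IsQuiverFlag) (hY : Q.IsYShaped) {i i' : Fin (ρ + 1)} (hi : i ≠ 0)
    (hi' : i' ≠ 0) {t t' : ℕ} (ht : t < Q.s i - Q.r i) (ht' : t' < Q.s i' - Q.r i')
    (hle : B.rowOffset i + t ≤ B.rowOffset i' + t') :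
    B.colOffset i ≤ B.colOffset i' ∧
      B.colOffset i + Q.sTilde i ≤ B.colOffset i' + Q.sTilde i' ∧
      (B.rowOffset i + t = B.rowOffset i' + t' → i = i') := by
  have hb := base_add hQ hY (B := B)
  rcases B.mem_S₁_or_mem_S₂' hY hi with h | h <;> rcases B.mem_S₁_or_mem_S₂' hY hi' with h' | h'
  · obtain ⟨e1, e2⟩ := offset_of_mem_S₁ h
    obtain ⟨e1', e2'⟩ := offset_of_mem_S₁ h'
    have b := bounds_of_mem_S₁ hQ hY h
    have b' := bounds_of_mem_S₁ hQ hY h'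
    rcases lt_trichotomy i i' with hlt | rfl | hlt
    · have := hQ.k_le_kPrev hY hi (reaches_of_mem_S₁ hQ hY h h' hlt.le) hlt.ne
      omega
    · exact ⟨le_rfl, le_rfl, fun _ => rfl⟩
    · have hr := reaches_of_mem_S₁ hQ hY h' h hlt.le
      have h3 := hQ.k_le_kPrev hY hi' hr hlt.ne
      have h4 := hQ.k_le_of_reaches hY hi' hr
      refine ⟨by omega, by omega, fun heq => ?_⟩
      omega
  · obtain ⟨e1, e2⟩ := offset_of_mem_S₁ h
    obtain ⟨e1', e2'⟩ := offset_of_mem_S₂' hQ hY h'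
    have b := bounds_of_mem_S₁ hQ hY h
    have b' := bounds_of_mem_S₂' hQ hY h'
    refine ⟨by omega, by omega, fun heq => ?_⟩
    omega
  · obtain ⟨e1, e2⟩ := offset_of_mem_S₂' hQ hY h
    obtain ⟨e1', e2'⟩ := offset_of_mem_S₁ h'
    have b := bounds_of_mem_S₂' hQ hY h
    have b' := bounds_of_mem_S₁ hQ hY h'
    omega
  · obtain ⟨e1, e2⟩ := offset_of_mem_S₂' hQ hY h
    obtain ⟨e1', e2'⟩ := offset_of_mem_S₂' hQ hY h'
    have b := bounds_of_mem_S₂' hQ hY h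
    have b' := bounds_of_mem_S₂' hQ hY h'
    have m := B.mem_S₂.2 (Or.inr h)
    have m' := B.mem_S₂.2 (Or.inr h')
    rcases lt_trichotomy i i' with hlt | rfl | hlt
    · have hr := reaches_of_mem_S₂ hQ hY m m' hlt.le
      have h3 := hQ.k_le_kPrev hY hi hr hlt.ne
      have h4 := hQ.k_le_of_reaches hY hi hr
      refine ⟨by omega, by omega, fun heq => ?_⟩
      omega
    · exact ⟨le_rfl, le_rfl, fun _ => rfl⟩
    · have := hQ.k_le_kPrev hY hi' (reaches_of_mem_S₂ hQ hY m' m hlt.le) hlt.ne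
      omega

theorem pos_injective (hQ : Q.IsQuiverFlag) (hY : Q.IsYShaped) : Function.Injective B.pos := by
  rintro ⟨i, t, c⟩ ⟨i', t', c'⟩ h
  obtain ⟨h1, h2⟩ := Prod.mk.injEq _ _ _ _ ▸ h
  have hi := hQ.coord_ne_zero ⟨i, t, c⟩
  have hi' := hQ.coord_ne_zero ⟨i', t', c'⟩
  simp only at h1 h2 hi hi'
  have heq : B.rowOffset i + t.val = B.rowOffset i' + t'.val := by omega
  obtain rfl := (block_mono hQ hY hi hi' t.isLt t'.isLt heq.le).2.2 heq
  have ht : t = t' := Fin.ext (by omega)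
  have hc : c = c' := Fin.ext (by omega)
  rw [ht, hc]

theorem isStair_placed (hQ : Q.IsQuiverFlag) (hY : Q.IsYShaped) : IsStair B.placed := by
  rintro p p' c c' d hp ⟨⟨i, t, k⟩, hy⟩ ⟨⟨i', t', k'⟩, hy'⟩ hcd hdc
  have hi := hQ.coord_ne_zero ⟨i, t, k⟩
  have hi' := hQ.coord_ne_zero ⟨i', t', k'⟩
  simp only [pos, Prod.mk.injEq] at hy hy' hi hi'
  obtain ⟨h1, h2, -⟩ := block_mono (B := B) hQ hY hi hi' t.isLt t'.isLt (by omega)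
  have hk := k.isLt
  have hk' := k'.isLt
  refine ⟨⟨⟨i, t, ⟨d - B.colOffset i - 1, by omega⟩⟩, ?_⟩,
    ⟨⟨i', t', ⟨d - B.colOffset i' - 1, by omega⟩⟩, ?_⟩⟩
  · simp only [pos, Prod.mk.injEq]
    omega
  · simp only [pos, Prod.mk.injEq]
    omega

/-- The coordinates in the rows of `M₁`. -/
theorem mem_S₁_and_iff (hQ : Q.IsQuiverFlag) (hY : Q.IsYShaped) (y : Q.Coord) {p c : ℕ}
    (hp : p ≤ Q.k B.last₁) :
    (y.1 ∈ B.S₁ ∧ B.row₁ y = p ∧ B.col₁ y = c) ↔ B.pos y = (p, c) := by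
  have hb := base_add hQ hY (B := B)
  simp only [pos, row₁, col₁, Prod.mk.injEq]
  rcases B.mem_S₁_or_mem_S₂' hY (hQ.coord_ne_zero y) with h | h
  · obtain ⟨e1, e2⟩ := offset_of_mem_S₁ h
    rw [e1, e2]
    simp [h]
  · obtain ⟨e1, e2⟩ := offset_of_mem_S₂' hQ hY h
    have b := bounds_of_mem_S₂' hQ hY h
    have hn := notMem_S₁_of_mem_S₂' hQ hY h
    -- A vertex of the second branch has `kPrev ≥ k 1`, so its rows start below row `base + k 1 =
    -- k_{ρ₁}`, the last one of `M₁`.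
    refine iff_of_false (fun hh => hn hh.1) fun hh => ?_
    omega

/-- The coordinates in the rows of `M₂`. -/
theorem mem_S₂_and_iff (hQ : Q.IsQuiverFlag) (hY : Q.IsYShaped) (y : Q.Coord) {p c : ℕ}
    (hp : 1 ≤ p) :
    (y.1 ∈ B.S₂ ∧ B.row₂ y = p ∧ B.col₂ y = c) ↔ B.pos y = (B.base + p, c) := by
  have hb := base_add hQ hY (B := B)
  simp only [pos, row₂, col₂, Prod.mk.injEq]
  rcases B.mem_S₁_or_mem_S₂' hY (hQ.coord_ne_zero y) with h | h
  · obtain ⟨e1, e2⟩ := offset_of_mem_S₁ h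
    have b := bounds_of_mem_S₁ hQ hY h
    rcases B.mem_S₁.1 h with h1 | h1
    -- Vertex 1 is placed by the convention of `M₁`; both conventions agree on it because `kPrev 1 =
    -- 0`.
    · have hk : Q.kPrev y.1 = 0 := (congrArg _ h1).trans (hQ.kPrev_one hY)
      have hk1 : Q.k y.1 = Q.k 1 := congrArg _ h1
      have hs1 : Q.sTilde y.1 = Q.sTilde 1 := congrArg _ h1
      simp only [B.mem_S₂.2 (Or.inl h1), true_and]
      omega
    -- The rows of a vertex of `S₁'` lie above the last `kPrev ≥ k 1` rows of `M₁`, thus within the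
    -- first `base` rows.
    · have h3 := one_le_kPrev_of_mem_S₁' hQ hY h1
      have hlt := y.2.1.isLt
      refine iff_of_false (fun hh => ?_) fun hh => ?_
      · rcases B.mem_S₂.1 hh.1 with h4 | h4
        · exact absurd h4 (one_lt_of_mem_S₁' hQ h1).ne'
        · exact notMem_S₁_of_mem_S₂' hQ hY h4 h
      · omega
  · obtain ⟨e1, e2⟩ := offset_of_mem_S₂' hQ hY h
    rw [e1, e2]
    simp only [B.mem_S₂.2 (Or.inr h), true_and]
    omega

open Classical in
theorem sum_coord_eq (hQ : Q.IsQuiverFlag) (hY : Q.IsYShaped) (p c : ℕ) :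
    (∑ y : Q.Coord, if B.pos y = (p, c) then (X (B.pos y) : MvPolynomial (ℕ × ℕ) ℂ) else 0) =
      genericMatrix B.placed p c := by
  unfold genericMatrix
  split_ifs with h
  · obtain ⟨y, hy⟩ := h
    rw [Finset.sum_eq_single y]
    · rw [if_pos hy, hy]
    · intro z _ hz
      rw [if_neg]
      exact fun h => hz (pos_injective hQ hY (h.trans hy.symm))
    · simp
  · refine Finset.sum_eq_zero fun y _ => if_neg fun hy => h ⟨y, hy⟩

theorem rename_M₁ (hQ : Q.IsQuiverFlag) (hY : Q.IsYShaped) {p : ℕ} (hp : p ≤ Q.k B.last₁)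
    (c : ℕ) : rename B.pos (B.M₁ p c) = genericMatrix B.placed p c := by
  classical
  rw [← sum_coord_eq hQ hY, M₁, map_sum]
  refine Finset.sum_congr rfl fun y _ => ?_
  rw [if_congr (mem_S₁_and_iff hQ hY y hp).symm rfl rfl]
  split_ifs <;> simp

theorem rename_M₂ (hQ : Q.IsQuiverFlag) (hY : Q.IsYShaped) {p : ℕ} (hp : 1 ≤ p)
    (c : ℕ) : rename B.pos (B.M₂ p c) = genericMatrix B.placed (B.base + p) c := by
  classical
  rw [← sum_coord_eq hQ hY, M₂, map_sum]
  refine Finset.sum_congr rfl fun y _ => ?_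
  rw [if_congr (mem_S₂_and_iff hQ hY y hp).symm rfl rfl]
  split_ifs <;> simp

theorem det_eq_intervalMinor {R : Type*} [CommRing R] (N : ℕ → ℕ → R) (σ : Finset ℕ) {u w : ℕ}
    (h : u + σ.card = w) :
    (Matrix.of fun i j : Fin σ.card => N (u + i.val) (σ.orderEmbOfFin rfl j)).det =
      intervalMinor N u w fun r => seqEntry σ (r - u) := by
  subst h
  have hb : Function.Bijective fun i : Fin σ.card =>
      (⟨u + i.val, Finset.mem_Ico.2 ⟨by omega, by omega⟩⟩ : Finset.Ico u (u + σ.card)) := by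
    constructor
    · intro i j hij
      simpa [Fin.ext_iff] using hij
    · rintro ⟨i, hi⟩
      rw [Finset.mem_Ico] at hi
      refine ⟨⟨i - u, by omega⟩, ?_⟩
      simp only [Subtype.mk.injEq]
      omega
  rw [intervalMinor, ← Matrix.det_submatrix_equiv_self (Equiv.ofBijective _ hb)]
  congr 1
  ext i j : 2
  simp [seqEntry_of_lt]

theorem rename_minor₁ (hQ : Q.IsQuiverFlag) (hY : Q.IsYShaped) {σ : Finset ℕ}
    (h : σ.card ≤ Q.k B.last₁) :
    rename B.pos (B.minor₁ σ) = intervalMinor (genericMatrix B.placed)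
      (Q.k B.last₁ + 1 - σ.card) (Q.k B.last₁ + 1)
      fun r => seqEntry σ (r - (Q.k B.last₁ + 1 - σ.card)) := by
  rw [← det_eq_intervalMinor _ σ (by omega), minor₁, AlgHom.map_det]
  congr 1
  ext i j : 2
  simp only [AlgHom.mapMatrix_apply, Matrix.map_apply, Matrix.of_apply]
  rw [rename_M₁ hQ hY (by omega), show Q.k B.last₁ - σ.card + i.val + 1 =
    Q.k B.last₁ + 1 - σ.card + i.val by omega]

theorem rename_minor₂ (hQ : Q.IsQuiverFlag) (hY : Q.IsYShaped) (σ : Finset ℕ) :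
    rename B.pos (B.minor₂ σ) = intervalMinor (genericMatrix B.placed)
      (B.base + 1) (B.base + 1 + σ.card) fun r => seqEntry σ (r - (B.base + 1)) := by
  rw [← det_eq_intervalMinor _ σ rfl, minor₂, AlgHom.map_det]
  congr 1
  ext i j : 2
  simp only [AlgHom.mapMatrix_apply, Matrix.map_apply, Matrix.of_apply]
  rw [rename_M₂ hQ hY (by omega), show B.base + (i.val + 1) = B.base + 1 + i.val by omega]

/-- The strict inequality is due to the use of `S₁'` in place of `S₁`: a p¹ minor reaches above the
shared rows, so minors of size `k 1` occur only as p². -/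
theorem card_var₁ (hQ : Q.IsQuiverFlag) (hY : Q.IsYShaped) (σ : B.Var₁) :
    Q.k 1 < σ.1.card ∧ σ.1.card ≤ Q.k B.last₁ := by
  obtain ⟨i, hi, hc⟩ := σ.2.2.1
  have h1 := one_le_kPrev_of_mem_S₁' hQ hY hi
  have h2 := B.mem_S₁.2 (Or.inr hi)
  have h3 := hQ.kPrev_lt hY (ne_zero_of_mem_S₁ hQ hY h2)
  have h4 := le_last₁ hQ hY h2
  omega

theorem card_var₂ (hQ : Q.IsQuiverFlag) (hY : Q.IsYShaped) (σ : B.Var₂) :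
    Q.k 1 ≤ σ.1.card := by
  obtain ⟨i, hi, hc⟩ := σ.2.2.1
  rw [hc]
  exact (hQ.k_le_of_reaches hY hY.one_ne_zero (reaches_of_mem_S₂ hQ hY one_mem_S₂ hi
      (hY.one_le_of_ne_zero (ne_zero_of_mem_S₂ hQ hY hi)))).1

/-! ### The variables as a system of interval minors -/

variable (B) in
/-- The first row of the minor of a variable in the glued matrix. -/
noncomputable def firstRow : B.Var → ℕ :=
  Sum.elim (fun σ => Q.k B.last₁ + 1 - σ.1.card) fun _ => B.base + 1

variable (B) in
/-- The row after the last row of the minor of a variable in the glued matrix. -/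
noncomputable def endRow : B.Var → ℕ :=
  Sum.elim (fun _ => Q.k B.last₁ + 1) fun σ => B.base + 1 + σ.1.card

variable (B) in
/-- The index set of a variable. -/
def indexSet : B.Var → Finset ℕ := Sum.elim (fun σ => σ.1) fun σ => σ.1

variable (B) in
/-- The diagonal entry of the index set of a variable in a given row. -/
noncomputable def entry (p : B.Var) (r : ℕ) : ℕ := seqEntry (B.indexSet p) (r - B.firstRow p)

theorem firstRow_add_card (hQ : Q.IsQuiverFlag) (hY : Q.IsYShaped) (p : B.Var) :
    B.firstRow p + (B.indexSet p).card = B.endRow p := by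
  rcases p with σ | σ
  · have := card_var₁ hQ hY σ
    simp only [firstRow, indexSet, endRow, Sum.elim_inl]
    omega
  · rfl

theorem card_image_Ico {u w : ℕ} {c : ℕ → ℕ} (hc : StrictMonoOn c (Set.Ico u w)) :
    ((Finset.Ico u w).image c).card = w - u := by
  rw [Finset.card_image_of_injOn (by simpa using hc.injOn), Nat.card_Ico]

theorem seqEntry_image_Ico {u w : ℕ} {c : ℕ → ℕ} (hc : StrictMonoOn c (Set.Ico u w)) {r : ℕ}
    (hr : r ∈ Set.Ico u w) : seqEntry ((Finset.Ico u w).image c) (r - u) = c r := by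
  obtain ⟨h1, h2⟩ := hr
  have hcard := card_image_Ico hc
  rw [seqEntry_of_lt (by omega)]
  have := Finset.orderEmbOfFin_unique (s := (Finset.Ico u w).image c) rfl
    (f := fun i => c (u + i.val))
    (fun i => Finset.mem_image_of_mem _ (Finset.mem_Ico.2 ⟨by omega, by omega⟩))
    (fun i j hij => hc ⟨by omega, by omega⟩ ⟨by omega, by omega⟩
      (Nat.add_lt_add_left (Fin.lt_def.1 hij) u))
  rw [← this]
  simp only
  congr 1
  omega

theorem rename_pos_ne_zero_iff (hQ : Q.IsQuiverFlag) (hY : Q.IsYShaped) {f : Q.CoordRing} :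
    rename B.pos f ≠ 0 ↔ f ≠ 0 :=
  map_ne_zero_iff _ (rename_injective _ (pos_injective hQ hY))

theorem rename_elim (hQ : Q.IsQuiverFlag) (hY : Q.IsYShaped) (p : B.Var) :
    rename B.pos (Sum.elim (fun σ : B.Var₁ => B.minor₁ σ.1) (fun σ : B.Var₂ => B.minor₂ σ.1) p) =
      intervalMinor (genericMatrix B.placed) (B.firstRow p) (B.endRow p) (B.entry p) := by
  rcases p with σ | σ
  · exact rename_minor₁ hQ hY (card_var₁ hQ hY σ).2
  · exact rename_minor₂ hQ hY σ.1

theorem entry_strictMonoOn (hQ : Q.IsQuiverFlag) (hY : Q.IsYShaped) (p : B.Var) :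
    StrictMonoOn (B.entry p) (Set.Ico (B.firstRow p) (B.endRow p)) := by
  rw [← firstRow_add_card hQ hY]
  exact seqEntry_strictMonoOn _ _

theorem image_entry (hQ : Q.IsQuiverFlag) (hY : Q.IsYShaped) (p : B.Var) :
    B.entry p '' Set.Ico (B.firstRow p) (B.endRow p) = B.indexSet p := by
  rw [← firstRow_add_card hQ hY]
  exact seqEntry_image _ _

/-- Variables of the two types never have the same rows: those of type p¹ begin at or above row
`base`, those of type p² at row `base + 1`. -/
theorem var_ext (hQ : Q.IsQuiverFlag) (hY : Q.IsYShaped) {p q : B.Var}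
    (hu : B.firstRow p = B.firstRow q) (hw : B.endRow p = B.endRow q)
    (h : ∀ r ∈ Set.Ico (B.firstRow p) (B.endRow p), B.entry p r = B.entry q r) : p = q := by
  have hset : B.indexSet p = B.indexSet q := by
    rw [← Finset.coe_inj, ← image_entry hQ hY, ← image_entry hQ hY, ← hu, ← hw]
    exact Set.image_congr h
  have hb := base_add hQ hY (B := B)
  rcases p with σ | σ <;> rcases q with τ | τ
  · exact congrArg Sum.inl (Subtype.ext hset)
  · have := card_var₁ hQ hY σ
    simp only [firstRow, Sum.elim_inl, Sum.elim_inr] at hu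
    omega
  · have := card_var₁ hQ hY τ
    simp only [firstRow, Sum.elim_inl, Sum.elim_inr] at hu
    omega
  · exact congrArg Sum.inr (Subtype.ext hset)

theorem placed_bounds₁ (hQ : Q.IsQuiverFlag) (hY : Q.IsYShaped) {r c : ℕ} (h : B.placed r c)
    (hr : r < Q.k B.last₁ + 1) : c ∈ Finset.Icc 1 (Q.sTilde B.last₁) := by
  obtain ⟨y, hy⟩ := h
  obtain ⟨h1, -, h2⟩ := (mem_S₁_and_iff hQ hY y (by omega)).2 hy
  have h3 := (le_last₁ hQ hY h1).2
  have h4 := y.2.2.isLt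
  unfold col₁ at h2
  rw [Finset.mem_Icc]
  omega

theorem placed_bounds₂ (hQ : Q.IsQuiverFlag) (hY : Q.IsYShaped) {r c : ℕ} (h : B.placed r c)
    (hr : B.base + 1 ≤ r) :
    c ∈ Finset.Icc (B.shift + 1) (B.shift + Q.sTilde B.last₂) := by
  obtain ⟨y, hy⟩ := h
  obtain ⟨p, rfl⟩ := Nat.exists_eq_add_of_le (show B.base ≤ r by omega)
  obtain ⟨h1, -, h2⟩ := (mem_S₂_and_iff hQ hY y (by omega)).2 hy
  have h3 := (le_last₂ hQ hY h1).2
  have h4 := y.2.2.isLt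
  unfold col₂ at h2
  rw [Finset.mem_Icc]
  omega

/-- The bound on the column indices required of a variable is automatic: a nonzero minor has its
diagonal in the staircase, whose rows lie in the column range of `M₁` or `M₂` respectively. -/
theorem exists_var (hQ : Q.IsQuiverFlag) (hY : Q.IsYShaped) (p : B.Var) (c : ℕ → ℕ)
    (hc : StrictMonoOn c (Set.Ico (B.firstRow p) (B.endRow p)))
    (h : intervalMinor (genericMatrix B.placed) (B.firstRow p) (B.endRow p) c ≠ 0) :
    ∃ q, B.firstRow q = B.firstRow p ∧ B.endRow q = B.endRow p ∧
      ∀ r ∈ Set.Ico (B.firstRow p) (B.endRow p), B.entry q r = c r := by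
  have hcard := card_image_Ico hc
  have hp := firstRow_add_card hQ hY p
  have hent : ∀ r ∈ Set.Ico (B.firstRow p) (B.endRow p),
      seqEntry ((Finset.Ico (B.firstRow p) (B.endRow p)).image c) (r - B.firstRow p) = c r :=
    fun r hr => seqEntry_image_Ico hc hr
  have hdiag := fun r hr => diag_mem_of_intervalMinor_ne_zero (isStair_placed hQ hY) hc h (r := r) hr
  rw [← intervalMinor_congr _ fun r hr => hent r (Finset.mem_Ico.1 hr)] at h
  set τ := (Finset.Ico (B.firstRow p) (B.endRow p)).image c with hτ
  rcases p with σ | σ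
  · have hcσ : τ.card = σ.1.card := by
      simp only [indexSet, Sum.elim_inl] at hp
      omega
    have hv := card_var₁ hQ hY σ
    have hu : B.firstRow (Sum.inl σ) = Q.k B.last₁ + 1 - τ.card := by
      rw [hcσ]
      rfl
    obtain ⟨i, hi, hik⟩ := σ.2.2.1
    refine ⟨Sum.inl ⟨τ, ?_, ⟨i, hi, hcσ.trans hik⟩, ?_⟩, hu.symm, rfl, fun r hr => ?_⟩
    · intro x hx
      obtain ⟨r, hr, rfl⟩ := Finset.mem_image.1 (hτ ▸ hx)
      exact placed_bounds₁ hQ hY (hdiag r hr) (Finset.mem_Ico.1 hr).2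
    · rw [← rename_pos_ne_zero_iff hQ hY, rename_minor₁ hQ hY (by omega), ← hu]
      exact h
    · exact (congrArg (fun u => seqEntry τ (r - u)) hu.symm).trans (hent r hr)
  · have hcσ : τ.card = σ.1.card := by
      simp only [indexSet, Sum.elim_inr] at hp
      omega
    have hw : B.endRow (Sum.inr σ) = B.base + 1 + τ.card := by
      rw [hcσ]
      rfl
    obtain ⟨i, hi, hik⟩ := σ.2.2.1
    refine ⟨Sum.inr ⟨τ, ?_, ⟨i, hi, hcσ.trans hik⟩, ?_⟩, rfl, hw.symm, fun r hr => ?_⟩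
    · intro x hx
      obtain ⟨r, hr, rfl⟩ := Finset.mem_image.1 (hτ ▸ hx)
      exact placed_bounds₂ hQ hY (hdiag r hr) (Finset.mem_Ico.1 hr).1
    · rw [← rename_pos_ne_zero_iff hQ hY, rename_minor₂ hQ hY, ← hw]
      exact h
    · exact hent r hr

variable (B) in
/-- The minors of `M₁` and `M₂` as interval minors of the glued matrix. -/
noncomputable def minorSystem (hQ : Q.IsQuiverFlag) (hY : Q.IsYShaped) : MinorSystem B.Var where
  S := B.placed
  stair := isStair_placed hQ hY
  u := B.firstRow
  w := B.endRow
  e := B.entry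
  core := B.base + 1
  u_le_core := by
    rintro (σ | σ)
    · have := card_var₁ hQ hY σ
      have := base_add hQ hY (B := B)
      simp only [firstRow, Sum.elim_inl]
      omega
    · exact le_rfl
  core_lt_w := by
    have hb := base_add hQ hY (B := B)
    have h1 := one_le_k_one hQ hY
    rintro (σ | σ)
    · simp only [endRow, Sum.elim_inl]
      omega
    · have := card_var₂ hQ hY σ
      simp only [endRow, Sum.elim_inr]
      omega
  total := by
    have hb := base_add hQ hY (B := B)
    rintro (σ | σ) (τ | τ)
    · simp only [firstRow, endRow, Sum.elim_inl]
      omega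
    · have := card_var₁ hQ hY σ
      have := card_var₂ hQ hY τ
      simp only [firstRow, endRow, Sum.elim_inl, Sum.elim_inr]
      omega
    · have := card_var₁ hQ hY τ
      have := card_var₂ hQ hY σ
      simp only [firstRow, endRow, Sum.elim_inl, Sum.elim_inr]
      omega
    · simp only [firstRow, endRow, Sum.elim_inr]
      omega
  strictMono := entry_strictMonoOn hQ hY
  ext _ _ := var_ext hQ hY
  ne_zero := by
    intro p
    rw [← rename_elim hQ hY, rename_pos_ne_zero_iff hQ hY]
    rcases p with σ | σ
    · exact σ.2.2.2
    · exact σ.2.2.2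
  exists_var := exists_var hQ hY

end DimQuiver.Branching

/-! ### Transfer of the orders, of independence and of straightening -/

namespace DimQuiver.Branching

open MvPolynomial StaircaseMinor

variable {ρ : ℕ} {Q : DimQuiver ρ} {B : Q.Branching}

/-- The three alignments of index sets are all alignments by rows of the glued matrix. In the mixed
case the common rows are exactly the `k 1` shared ones, which are the first rows of the p² minor and
the last rows of the p¹ minor. -/
theorem varLE_iff (hQ : Q.IsQuiverFlag) (hY : Q.IsYShaped) (p q : B.Var) :
    B.varLE p q ↔ (B.minorSystem hQ hY).le p q := by
  have hb := base_add hQ hY (B := B)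
  have h1 := one_le_k_one hQ hY
  simp only [MinorSystem.le, minorSystem]
  rcases p with σ | σ <;> rcases q with τ | τ <;>
  simp only [varLE, firstRow, endRow, entry, indexSet, Sum.elim_inl, Sum.elim_inr, Set.mem_Ico]
  · have hσ := card_var₁ hQ hY σ
    have hτ := card_var₁ hQ hY τ
    constructor
    · rintro ⟨hc, h⟩
      refine ⟨by omega, le_rfl, fun r hr => ?_⟩
      have := h (r - (Q.k B.last₁ + 1 - σ.1.card)) (by omega)
      rwa [show τ.1.card - σ.1.card + (r - (Q.k B.last₁ + 1 - σ.1.card)) =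
        r - (Q.k B.last₁ + 1 - τ.1.card) by omega] at this
    · rintro ⟨hc, -, h⟩
      refine ⟨by omega, fun s hs => ?_⟩
      have := h (Q.k B.last₁ + 1 - σ.1.card + s) (by omega)
      rwa [show Q.k B.last₁ + 1 - σ.1.card + s - (Q.k B.last₁ + 1 - σ.1.card) = s by omega,
        show Q.k B.last₁ + 1 - σ.1.card + s - (Q.k B.last₁ + 1 - τ.1.card) =
          τ.1.card - σ.1.card + s by omega] at this
  · have hσ := card_var₁ hQ hY σ
    refine iff_of_false id fun h => ?_
    omega
  · have hσ := card_var₂ hQ hY σ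
    have hτ := card_var₁ hQ hY τ
    constructor
    · intro h
      refine ⟨by omega, by omega, fun r hr => ?_⟩
      have := h (r - (B.base + 1)) (by omega)
      rwa [show τ.1.card - Q.k 1 + (r - (B.base + 1)) =
        r - (Q.k B.last₁ + 1 - τ.1.card) by omega] at this
    · rintro ⟨-, -, h⟩ s hs
      have := h (B.base + 1 + s) (by omega)
      rwa [show B.base + 1 + s - (B.base + 1) = s by omega,
        show B.base + 1 + s - (Q.k B.last₁ + 1 - τ.1.card) =
          τ.1.card - Q.k 1 + s by omega] at this
  · constructor
    · rintro ⟨hc, h⟩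
      exact ⟨le_rfl, by omega, fun r hr => h _ (by omega)⟩
    · rintro ⟨-, hc, h⟩
      refine ⟨by omega, fun s hs => ?_⟩
      have := h (B.base + 1 + s) (by omega)
      rwa [show B.base + 1 + s - (B.base + 1) = s by omega] at this

theorem seqLexLT_iff {σ τ : Finset ℕ} {u u' w : ℕ} (hw : u + σ.card = w) (hu : u' = u) :
    seqLexLT σ τ ↔ ∃ r ∈ Set.Ico u w, (∀ t ∈ Set.Ico u r,
      seqEntry σ (t - u) = seqEntry τ (t - u')) ∧ seqEntry σ (r - u) < seqEntry τ (r - u') := by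
  subst hw hu
  constructor
  · rintro ⟨s, hs, hst, hlt⟩
    refine ⟨u' + s, ⟨by omega, by omega⟩, fun t ht => hst _ ?_, ?_⟩
    · have := ht.1
      have := ht.2
      omega
    · rwa [show u' + s - u' = s by omega]
  · rintro ⟨r, ⟨hr1, hr2⟩, hrt, hlt⟩
    refine ⟨r - u', by omega, fun t ht => ?_, hlt⟩
    have := hrt (u' + t) ⟨by omega, by omega⟩
    rwa [show u' + t - u' = t by omega] at this

theorem varLT_iff (hQ : Q.IsQuiverFlag) (hY : Q.IsYShaped) (p q : B.Var) :
    B.varLT p q ↔ (B.minorSystem hQ hY).lt p q := by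
  have hb := base_add hQ hY (B := B)
  have h1 := one_le_k_one hQ hY
  have hlex : B.firstRow q = B.firstRow p →
      (seqLexLT (B.indexSet p) (B.indexSet q) ↔ ∃ r ∈ Set.Ico (B.firstRow p) (B.endRow p),
        (∀ t ∈ Set.Ico (B.firstRow p) r, B.entry p t = B.entry q t) ∧ B.entry p r < B.entry q r) :=
    seqLexLT_iff (firstRow_add_card hQ hY p)
  simp only [MinorSystem.lt, minorSystem]
  rw [← and_assoc (a := B.firstRow q = B.firstRow p),
    ← and_congr_right (a := B.firstRow q = B.firstRow p ∧ B.endRow q = B.endRow p)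
      fun h => hlex h.1]
  clear hlex
  rcases p with σ | σ <;> rcases q with τ | τ <;>
  simp only [varLT, firstRow, endRow, indexSet, Sum.elim_inl, Sum.elim_inr, and_true, true_and]
  · have hσ := card_var₁ hQ hY σ
    have hτ := card_var₁ hQ hY τ
    refine or_congr (by omega) (and_congr_left fun _ => by omega)
  · have hσ := card_var₁ hQ hY σ
    refine iff_of_false id ?_
    rintro (h | ⟨h, -⟩) <;> omega
  · have hσ := card_var₂ hQ hY σ
    have hτ := card_var₁ hQ hY τ
    refine iff_of_true trivial (Or.inl (by omega))
  · refine or_congr (by omega) (and_congr_left fun _ => by omega)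

theorem varLT_irrefl (hQ : Q.IsQuiverFlag) (hY : Q.IsYShaped) (p : B.Var) : ¬ B.varLT p p := by
  rw [varLT_iff hQ hY]
  exact MinorSystem.lt_irrefl _ p

theorem varLT_trans (hQ : Q.IsQuiverFlag) (hY : Q.IsYShaped) {p q s : B.Var} (h : B.varLT p q)
    (h' : B.varLT q s) : B.varLT p s := by
  rw [varLT_iff hQ hY] at *
  exact MinorSystem.lt_trans _ h h'

theorem varLT_trichotomy (hQ : Q.IsQuiverFlag) (hY : Q.IsYShaped) (p q : B.Var) :
    B.varLT p q ∨ p = q ∨ B.varLT q p := by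
  rw [varLT_iff hQ hY, varLT_iff hQ hY]
  exact MinorSystem.lt_trichotomy _ p q

/-- Renaming coordinates by their places is injective, so independence and straightening can be
pulled back from the glued matrix. -/
theorem rename_phi (hQ : Q.IsQuiverFlag) (hY : Q.IsYShaped) (f : B.PRing) :
    rename B.pos (B.phi f) = aeval (B.minorSystem hQ hY).minor f := by
  have h : (rename (R := ℂ) B.pos).comp B.phi = aeval (B.minorSystem hQ hY).minor := by
    refine algHom_ext fun p => ?_
    rw [AlgHom.comp_apply, phi, aeval_X, aeval_X, rename_elim hQ hY]
    rfl
  rw [← h, AlgHom.comp_apply]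

theorem isSemistandard_iff (hQ : Q.IsQuiverFlag) (hY : Q.IsYShaped) (m : B.Var →₀ ℕ) :
    B.IsSemistandard m ↔ IsChain (B.minorSystem hQ hY).le (m.support : Set B.Var) := by
  rw [IsSemistandard, show B.varLE = (B.minorSystem hQ hY).le from
    funext fun p => funext fun q => propext (varLE_iff hQ hY p q)]

theorem linearIndependent_semistandard (hQ : Q.IsQuiverFlag) (hY : Q.IsYShaped) :
    LinearIndependent ℂ (fun m : {m : B.Var →₀ ℕ // B.IsSemistandard m} =>
      B.phi (monomial m.1 1)) := by
  refine LinearIndependent.of_comp (rename (R := ℂ) B.pos).toLinearMap ?_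
  have h := (B.minorSystem hQ hY).linearIndependent_chain.comp
    (fun m : {m : B.Var →₀ ℕ // B.IsSemistandard m} => ⟨m.1, (isSemistandard_iff hQ hY m.1).1 m.2⟩)
    (fun m m' hmm => Subtype.ext (congrArg (fun x => x.1) hmm))
  rwa [show (rename (R := ℂ) B.pos).toLinearMap ∘ (fun m : {m : B.Var →₀ ℕ // B.IsSemistandard m} =>
    B.phi (monomial m.1 1)) = _ from funext fun m => rename_phi hQ hY _]

/-- The straightening of a product of two incomparable variables. -/
theorem phi_X_mul_X_mem_span (hQ : Q.IsQuiverFlag) (hY : Q.IsYShaped) {p q : B.Var}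
    (hpq : B.varLT p q) (hle : ¬ B.varLE p q) :
    B.phi (X p * X q) ∈
      Submodule.span ℂ {x | ∃ p' q', B.varLT p' p ∧ x = B.phi (X p' * X q')} := by
  rw [varLT_iff hQ hY] at hpq
  rw [varLE_iff hQ hY] at hle
  have h := (B.minorSystem hQ hY).minor_mul_mem_span_of_not_le hpq hle
  have hr : ∀ p q : B.Var, (rename (R := ℂ) B.pos).toLinearMap (B.phi (X p * X q)) =
      (B.minorSystem hQ hY).minor p * (B.minorSystem hQ hY).minor q := by
    intro p q
    rw [AlgHom.toLinearMap_apply, rename_phi hQ hY, map_mul, aeval_X, aeval_X]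
  have hinj : Function.Injective (rename (R := ℂ) B.pos).toLinearMap :=
    rename_injective _ (pos_injective hQ hY)
  have himg : {x | ∃ p' q', (B.minorSystem hQ hY).lt p' p ∧ x =
      (B.minorSystem hQ hY).minor p' * (B.minorSystem hQ hY).minor q'} =
      (rename (R := ℂ) B.pos).toLinearMap ''
        {x | ∃ p' q', B.varLT p' p ∧ x = B.phi (X p' * X q')} := by
    ext x
    constructor
    · rintro ⟨p', q', hlt, rfl⟩
      exact ⟨_, ⟨p', q', (varLT_iff hQ hY _ _).2 hlt, rfl⟩, hr _ _⟩
    · rintro ⟨_, ⟨p', q', hlt, rfl⟩, rfl⟩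
      exact ⟨p', q', (varLT_iff hQ hY _ _).1 hlt, hr _ _⟩
  rw [himg, ← Submodule.map_span, ← hr] at h
  obtain ⟨y, hy, hyx⟩ := h
  rwa [← hinj hyx]

theorem finite_var : Finite B.Var := by
  have h1 : Finite B.Var₁ := Set.Finite.subset
    (Finset.finite_toSet (Finset.Icc 1 (Q.sTilde B.last₁)).powerset)
    fun σ hσ => Finset.mem_coe.2 (Finset.mem_powerset.2 hσ.1)
  have h2 : Finite B.Var₂ := Set.Finite.subset
    (Finset.finite_toSet
      (Finset.Icc (B.shift + 1) (B.shift + Q.sTilde B.last₂)).powerset)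
    fun σ hσ => Finset.mem_coe.2 (Finset.mem_powerset.2 hσ.1)
  exact inferInstance

/-! ### The reverse lexicographic order and incomparable pairs -/

theorem monomialLT_irrefl (m : B.Var →₀ ℕ) : ¬ B.monomialLT m m := by
  rintro (h | ⟨-, p, -, h⟩) <;> exact absurd h (lt_irrefl _)

theorem monomialLT_trans (hQ : Q.IsQuiverFlag) (hY : Q.IsYShaped) {a b c : B.Var →₀ ℕ}
    (h : B.monomialLT a b) (h' : B.monomialLT b c) : B.monomialLT a c := by
  rcases h with h | ⟨h, p, hp, hlt⟩ <;> rcases h' with h' | ⟨h', q, hq, hlt'⟩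
  · exact Or.inl (h.trans h')
  · exact Or.inl (h' ▸ h)
  · exact Or.inl (h ▸ h')
  · refine Or.inr ⟨h.trans h', ?_⟩
    rcases varLT_trichotomy hQ hY p q with hpq | rfl | hpq
    · exact ⟨p, fun x hx => (hp x hx).trans (hq x (varLT_trans hQ hY hx hpq)), hq p hpq ▸ hlt⟩
    · exact ⟨p, fun x hx => (hp x hx).trans (hq x hx), hlt'.trans hlt⟩
    · exact ⟨q, fun x hx => (hp x (varLT_trans hQ hY hx hpq)).trans (hq x hx), hp q hpq ▸ hlt'⟩

theorem monomialLT_add {a b : B.Var →₀ ℕ} (h : B.monomialLT a b) (c : B.Var →₀ ℕ) :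
    B.monomialLT (a + c) (b + c) := by
  rcases h with h | ⟨h, p, hp, hlt⟩
  · refine Or.inl ?_
    rw [map_add, map_add]
    omega
  · refine Or.inr ⟨by rw [map_add, map_add, h], p, fun q hq => ?_, ?_⟩
    · rw [Finsupp.add_apply, Finsupp.add_apply, hp q hq]
    · rw [Finsupp.add_apply, Finsupp.add_apply]
      omega

/-- A product of two variables is smaller if it contains a variable smaller than all those of the
other product. -/
theorem monomialLT_of_varLT (hQ : Q.IsQuiverFlag) (hY : Q.IsYShaped) {p q p' : B.Var}
    (q' : B.Var) (hpq : B.varLT p q) (hp' : B.varLT p' p) :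
    B.monomialLT (Finsupp.single p' 1 + Finsupp.single q' 1)
      (Finsupp.single p 1 + Finsupp.single q 1) := by
  classical
  have key : ∀ x y : B.Var, B.varLT x p → (B.varLT x y ∨ x = y) →
      ∃ z, (∀ t, B.varLT t z → (Finsupp.single x 1 + Finsupp.single y 1 : B.Var →₀ ℕ) t =
        (Finsupp.single p 1 + Finsupp.single q 1 : B.Var →₀ ℕ) t) ∧
        (Finsupp.single p 1 + Finsupp.single q 1 : B.Var →₀ ℕ) z <
          (Finsupp.single x 1 + Finsupp.single y 1 : B.Var →₀ ℕ) z := by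
    intro x y hxp hxy
    have hne : ∀ t s, B.varLT t s → s ≠ t := by
      rintro t _ h rfl
      exact varLT_irrefl hQ hY _ h
    refine ⟨x, fun t ht => ?_, ?_⟩
    · have hty : y ≠ t := by
        rcases hxy with h | rfl
        · exact hne _ _ (varLT_trans hQ hY ht h)
        · exact hne _ _ ht
      have htp := varLT_trans hQ hY ht hxp
      simp [hne _ _ ht, hty, hne _ _ htp, hne _ _ (varLT_trans hQ hY htp hpq)]
    · simp [hne _ _ hxp, hne _ _ (varLT_trans hQ hY hxp hpq)]
  refine Or.inr ⟨by simp, ?_⟩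
  -- The deciding variable is the smaller of `p'` and `q'`: it precedes both `p` and `q`, and
  -- nothing before it occurs in either product.
  rcases varLT_trichotomy hQ hY p' q' with h | h | h
  · exact key p' q' hp' (Or.inl h)
  · exact key p' q' hp' (Or.inr h)
  · rw [add_comm (Finsupp.single p' 1)]
    exact key q' p' (varLT_trans hQ hY h hp') (Or.inl h)

/-- A monomial that is not semi-standard is divisible by a product of two incomparable
variables. -/
theorem exists_incomparable (hQ : Q.IsQuiverFlag) (hY : Q.IsYShaped) {m : B.Var →₀ ℕ}
    (hm : ¬ B.IsSemistandard m) : ∃ p q m', B.varLT p q ∧ ¬ B.varLE p q ∧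
      m = Finsupp.single p 1 + Finsupp.single q 1 + m' := by
  classical
  have hdiv : ∀ p ∈ m.support, ∀ q ∈ m.support, p ≠ q →
      ∃ m', m = Finsupp.single p 1 + Finsupp.single q 1 + m' := by
    intro p hp q hq hpq
    refine ⟨m - (Finsupp.single p 1 + Finsupp.single q 1), (add_tsub_cancel_of_le ?_).symm⟩
    intro x
    rw [Finsupp.mem_support_iff] at hp hq
    rw [Finsupp.add_apply, Finsupp.single_apply, Finsupp.single_apply]
    split_ifs with h1 h2 h2
    · exact absurd (h1.trans h2.symm) hpq
    · subst h1; omega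
    · subst h2; omega
    · omega
  unfold IsSemistandard IsChain Set.Pairwise at hm
  push Not at hm
  obtain ⟨p, hp, q, hq, hpq, h1, h2⟩ := hm
  rcases varLT_trichotomy hQ hY p q with h | h | h
  · obtain ⟨m', hm'⟩ := hdiv p hp q hq hpq
    exact ⟨p, q, m', h, h1, hm'⟩
  · exact absurd h hpq
  · obtain ⟨m', hm'⟩ := hdiv q hq p hp hpq.symm
    exact ⟨q, p, m', h, h2, hm'⟩

theorem monomial_pair (p q : B.Var) :
    (monomial (Finsupp.single p 1 + Finsupp.single q 1) 1 : B.PRing) = X p * X q := by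
  rw [X, X, monomial_mul, one_mul]

/-! ### Spanning by semi-standard monomials -/

/-- The image of a monomial is a combination of the images of smaller semi-standard monomials. -/
theorem phi_monomial_mem_span (hQ : Q.IsQuiverFlag) (hY : Q.IsYShaped) (m : B.Var →₀ ℕ) :
    B.phi (monomial m 1) ∈ Submodule.span ℂ ((fun n => B.phi (monomial n 1)) ''
      {n | B.IsSemistandard n ∧ (n = m ∨ B.monomialLT n m)}) := by
  have := finite_var (B := B)
  have : IsStrictOrder (B.Var →₀ ℕ) B.monomialLT :=
    { irrefl := monomialLT_irrefl
      trans := fun _ _ _ => monomialLT_trans hQ hY }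
  -- Straightening preserves the degree, so well-foundedness is needed only on the finite set of
  -- monomials of one degree.
  have hfin : {n : B.Var →₀ ℕ | n.degree = m.degree}.Finite :=
    (Finsupp.finite_of_degree_le m.degree).subset fun n hn => le_of_eq hn
  refine (hfin.wellFoundedOn (r := B.monomialLT)).induction
    (P := fun m => B.phi (monomial m 1) ∈ Submodule.span ℂ ((fun n => B.phi (monomial n 1)) ''
      {n | B.IsSemistandard n ∧ (n = m ∨ B.monomialLT n m)})) rfl ?_
  intro k hk ih
  by_cases hss : B.IsSemistandard k
  · exact Submodule.subset_span ⟨k, ⟨hss, Or.inl rfl⟩, rfl⟩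
  obtain ⟨p, q, k', hpq, hle, hkk⟩ := exists_incomparable hQ hY hss
  have hprod : ∀ a : B.Var →₀ ℕ, B.phi (monomial (a + k') 1) =
      LinearMap.mulRight ℂ (B.phi (monomial k' 1)) (B.phi (monomial a 1)) := by
    intro a
    rw [LinearMap.mulRight_apply, ← map_mul, monomial_mul, one_mul]
  have h1 := phi_X_mul_X_mem_span hQ hY hpq hle
  rw [← monomial_pair] at h1
  have h2 := Submodule.mem_map_of_mem (f := LinearMap.mulRight ℂ (B.phi (monomial k' 1))) h1
  rw [← hprod, ← hkk, Submodule.map_span] at h2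
  refine Submodule.span_le.2 ?_ h2
  rintro _ ⟨_, ⟨p', q', hp', rfl⟩, rfl⟩
  rw [← monomial_pair, ← hprod]
  have hlt := monomialLT_add (monomialLT_of_varLT hQ hY q' hpq hp') k'
  rw [← hkk] at hlt
  refine Submodule.span_mono (Set.image_mono ?_) (ih _ ?_ hlt)
  · rintro n ⟨hn, rfl | hn'⟩
    · exact ⟨hn, Or.inr hlt⟩
    · exact ⟨hn, Or.inr (monomialLT_trans hQ hY hn' hlt)⟩
  · rw [Set.mem_ofPred_eq] at hk ⊢
    rw [← hk, hkk]
    simp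

theorem span_semistandard (hQ : Q.IsQuiverFlag) (hY : Q.IsYShaped) :
    Submodule.span ℂ (Set.range (fun m : {m : B.Var →₀ ℕ // B.IsSemistandard m} =>
      B.phi (monomial m.1 1))) = Subalgebra.toSubmodule B.pluckerAlgebra := by
  refine le_antisymm (Submodule.span_le.2 ?_) ?_
  · rintro _ ⟨m, rfl⟩
    exact ⟨_, rfl⟩
  · rintro _ ⟨f, rfl⟩
    change B.phi f ∈ _
    rw [as_sum f, map_sum]
    refine Submodule.sum_mem _ fun n _ => ?_
    rw [show monomial n (coeff n f) = coeff n f • (monomial n 1 : B.PRing) by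
      rw [smul_monomial, smul_eq_mul, mul_one], map_smul]
    refine Submodule.smul_mem _ _ (Submodule.span_mono ?_ (phi_monomial_mem_span hQ hY n))
    rintro _ ⟨l, ⟨hl, -⟩, rfl⟩
    exact ⟨⟨l, hl⟩, rfl⟩

/-! ### The initial ideal of the kernel -/

/-- Up to a factor, the terms other than the initial one straighten to semi-standard monomials
which are smaller than the initial monomial. -/
theorem phi_monomial_mem_span_lt (hQ : Q.IsQuiverFlag) (hY : Q.IsYShaped) {f : B.PRing}
    (hf : B.phi f = 0) {m k : B.Var →₀ ℕ} (hm : B.IsInitialMonomial f m) :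
    B.phi (monomial (m + k) 1) ∈ Submodule.span ℂ ((fun n => B.phi (monomial n 1)) ''
      {n | B.IsSemistandard n ∧ B.monomialLT n (m + k)}) := by
  classical
  have hc : coeff m f ≠ 0 := mem_support_iff.1 hm.1
  have hterm : ∀ n, B.phi (monomial n (coeff n f)) * B.phi (monomial k 1) =
      coeff n f • B.phi (monomial (n + k) 1) := by
    intro n
    rw [← map_mul, monomial_mul, mul_one, ← map_smul, smul_monomial, smul_eq_mul, mul_one]
  have h0 : ∑ n ∈ f.support, coeff n f • B.phi (monomial (n + k) 1) = 0 := by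
    simp only [← hterm]
    rw [← Finset.sum_mul, ← map_sum, ← as_sum, hf, zero_mul]
  rw [← Finset.add_sum_erase _ _ hm.1] at h0
  refine (Submodule.smul_mem_iff _ hc).1 ?_
  rw [eq_neg_of_add_eq_zero_left h0]
  refine Submodule.neg_mem _ (Submodule.sum_mem _ fun n hn => Submodule.smul_mem _ _ ?_)
  have hlt := monomialLT_add (hm.2 n (Finset.mem_of_mem_erase hn) (Finset.ne_of_mem_erase hn)) k
  refine Submodule.span_mono (Set.image_mono ?_) (phi_monomial_mem_span hQ hY (n + k))
  rintro l ⟨hl, rfl | hl'⟩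
  · exact ⟨hl, hlt⟩
  · exact ⟨hl, monomialLT_trans hQ hY hl' hlt⟩

theorem notMem_initialIdeal_of_isSemistandard (hQ : Q.IsQuiverFlag) (hY : Q.IsYShaped)
    {m : B.Var →₀ ℕ} (hm : B.IsSemistandard m) :
    monomial m (1 : ℂ) ∉ B.initialIdeal (RingHom.ker B.phi) := by
  intro h
  have hset : {g : B.PRing | ∃ f ∈ RingHom.ker B.phi, ∃ m, B.IsInitialMonomial f m ∧
      g = monomial m 1} = (fun s => monomial s 1) '' {s | ∃ f ∈ RingHom.ker B.phi,
        B.IsInitialMonomial f s} := by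
    ext g
    constructor
    · rintro ⟨f, hf, s, hs, rfl⟩
      exact ⟨s, ⟨f, hf, hs⟩, rfl⟩
    · rintro ⟨s, ⟨f, hf, hs⟩, rfl⟩
      exact ⟨f, hf, s, hs, rfl⟩
  rw [initialIdeal, hset, mem_ideal_span_monomial_image] at h
  -- Membership in a monomial ideal means divisibility by a generator: `m = s + k` with `s` the
  -- initial exponent of some `f` in the kernel. Multiplying `f` by the monomial `k` then expresses
  -- the image of `m` through smaller semi-standard ones.
  obtain ⟨s, ⟨f, hf, hs⟩, hsm⟩ := h m (by classical simp [support_monomial])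
  obtain ⟨k, rfl⟩ := exists_add_of_le hsm
  have h1 := phi_monomial_mem_span_lt hQ hY hf hs (k := k)
  have h2 := (linearIndependent_semistandard hQ hY (B := B)).notMem_span_image
    (s := {n | B.monomialLT n.1 (s + k)}) (x := ⟨s + k, hm⟩) (monomialLT_irrefl _)
  apply h2
  refine Submodule.span_mono ?_ h1
  rintro _ ⟨n, ⟨hn, hlt⟩, rfl⟩
  exact ⟨⟨n, hn⟩, hlt, rfl⟩

/-- The straightening relation of two incomparable variables, with its initial monomial. -/
theorem exists_straightening_relation (hQ : Q.IsQuiverFlag) (hY : Q.IsYShaped) {p q : B.Var}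
    (hpq : B.varLT p q) (hle : ¬ B.varLE p q) : ∃ f ∈ RingHom.ker B.phi,
      B.IsInitialMonomial f (Finsupp.single p 1 + Finsupp.single q 1) := by
  classical
  have h := phi_X_mul_X_mem_span hQ hY hpq hle
  have himg : {x | ∃ p' q', B.varLT p' p ∧ x = B.phi (X p' * X q')} =
      B.phi.toLinearMap '' ((fun n => monomial n (1 : ℂ)) ''
        {n | ∃ p' q', B.varLT p' p ∧ n = Finsupp.single p' 1 + Finsupp.single q' 1}) := by
    ext x
    constructor
    · rintro ⟨p', q', hlt, rfl⟩
      exact ⟨_, ⟨_, ⟨p', q', hlt, rfl⟩, rfl⟩, congrArg B.phi (monomial_pair p' q')⟩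
    · rintro ⟨_, ⟨_, ⟨p', q', hlt, rfl⟩, rfl⟩, rfl⟩
      exact ⟨p', q', hlt, congrArg B.phi (monomial_pair p' q')⟩
  rw [himg, ← Submodule.map_span] at h
  obtain ⟨g, hg, hgp⟩ := h
  have hsupp : ∀ n ∈ g.support, B.monomialLT n (Finsupp.single p 1 + Finsupp.single q 1) := by
    intro n hn
    have : g ∈ restrictSupport ℂ
        {n | ∃ p' q', B.varLT p' p ∧ n = Finsupp.single p' 1 + Finsupp.single q' 1} := by
      rwa [restrictSupport_eq_span]
    obtain ⟨p', q', hp', rfl⟩ := this hn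
    exact monomialLT_of_varLT hQ hY q' hpq hp'
  -- All the terms of `g` are strictly smaller than the incomparable product, so this product
  -- survives in `X p * X q - g` with coefficient 1.
  have hnot : coeff (Finsupp.single p 1 + Finsupp.single q 1) g = 0 := by
    by_contra h0
    exact monomialLT_irrefl _ (hsupp _ (mem_support_iff.2 h0))
  refine ⟨X p * X q - g, ?_, ?_, fun n hn hne => hsupp n ?_⟩
  · rw [RingHom.mem_ker, map_sub, sub_eq_zero]
    exact hgp.symm
  · rw [mem_support_iff, coeff_sub, hnot, ← monomial_pair, coeff_monomial, if_pos rfl, sub_zero]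
    exact one_ne_zero
  · rw [mem_support_iff, coeff_sub, ← monomial_pair, coeff_monomial, if_neg hne.symm,
      zero_sub, neg_ne_zero] at hn
    exact mem_support_iff.2 hn

theorem mem_initialIdeal_of_not_isSemistandard (hQ : Q.IsQuiverFlag) (hY : Q.IsYShaped)
    {m : B.Var →₀ ℕ} (hm : ¬ B.IsSemistandard m) :
    monomial m (1 : ℂ) ∈ B.initialIdeal (RingHom.ker B.phi) := by
  obtain ⟨p, q, m', hpq, hle, rfl⟩ := exists_incomparable hQ hY hm
  obtain ⟨f, hf, hfm⟩ := exists_straightening_relation hQ hY hpq hle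
  rw [show (monomial (Finsupp.single p 1 + Finsupp.single q 1 + m') 1 : B.PRing) =
    monomial (Finsupp.single p 1 + Finsupp.single q 1) 1 * monomial m' 1 by
      rw [monomial_mul, one_mul]]
  exact Ideal.mul_mem_right _ _ (Ideal.subset_span ⟨f, hf, _, hfm, rfl⟩)

end DimQuiver.Branching

theorem mainTheorem5 {ρ : ℕ} (Q : DimQuiver ρ) (hQ : Q.IsQuiverFlag) (hY : Q.IsYShaped)
    (B : Q.Branching) :
    (LinearIndependent ℂ (fun m : {m : B.Var →₀ ℕ // B.IsSemistandard m} =>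
        B.phi (MvPolynomial.monomial m.1 1)) ∧
      Submodule.span ℂ (Set.range (fun m : {m : B.Var →₀ ℕ // B.IsSemistandard m} =>
        B.phi (MvPolynomial.monomial m.1 1))) = Subalgebra.toSubmodule B.pluckerAlgebra) ∧
    (∀ m : B.Var →₀ ℕ,
      MvPolynomial.monomial m (1 : ℂ) ∉ B.initialIdeal (RingHom.ker B.phi) ↔
        B.IsSemistandard m) := by
  refine ⟨⟨DimQuiver.Branching.linearIndependent_semistandard hQ hY,
    DimQuiver.Branching.span_semistandard hQ hY⟩, fun m => ⟨fun h => ?_, fun h => ?_⟩⟩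
  · by_contra hm
    exact h (DimQuiver.Branching.mem_initialIdeal_of_not_isSemistandard hQ hY hm)
  · exact DimQuiver.Branching.notMem_initialIdeal_of_isSemistandard hQ hY h
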